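/- **Proposition (Achievable secrecy rate).** *Channel.* Let $\mathcal S$ be a finite non-empty set of states, $\mathcal X=\{0,1\}$, and let $\mathcal Y,\mathcal Z$ be finite. Each $s\in\mathcal S$ is a discrete memoryless wiretap channel $p^{(s)}_{YZ|X}$, with secrecy capacity $\mathrm C_s(s)=\max_{U\to X\to (Y,Z)}[I(U;Y)-I(U;Z)]$ ($U$ with finite alphabet, entropies in bits). The state is constant during the $N=2^n$ channel uses of a round and changes from round to round according to a hidden Markov model $\lambda=(\mathbf A,\mathbf B,\pi)$ with states $\mathcal S$ and a finite observation set $\mathcal O$, started with law $\pi$ in the first round. The universal secrecy capacity $\mathrm C_{us}$ is the supremum of the rates $R$ for which there are codes (stochastic encoder and decoder, $\lceil 2^{NR}\rceil$ equiprobable messages, block length $N$) that do not depend on the state and whose error probability and information leakage $I(M;Z^N)$ both tend to $0$ as $N\to\infty$ for every $s\in\mathcal S$. *Index sets.* Let $0<\beta<1/2$, $\delta_N=2^{-N^\beta}$. For each $s$ fix an input distribution $p_X^{(s)}$ (for instance one achieving the capacity of the main channel), let $(X_j,Y_j,Z_j)_{j\le N}$ be i.i.d. with law $p_X^{(s)}p^{(s)}_{YZ|X}$,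 and let $X^N=U^N\mathbf G_N$, $\mathbf G_N=\mathbf R\begin{bmatrix}1&0\\1&1\end{bmatrix}^{\otimes n}$ over $\mathbb F_2$, with $\mathbf R$ the bit reversal matrix. With the Bhattacharyya parameter $Z(A|B)=2\sum_b p_B(b)\sqrt{p_{A|B}(0|b)p_{A|B}(1|b)}$ put $$\mathcal H_X=\{j:Z(U_j|U_1^{j-1})\ge1-\delta_N\},\quad \mathcal L_{X|Y}=\{j:Z(U_j|U_1^{j-1},Y^N)\le\delta_N\},\quad \mathcal H_{X|Z}=\{j:Z(U_j|U_1^{j-1},Z^N)\ge1-\delta_N\},$$ $\mathcal I^{(s)}=\mathcal H_X\cap\mathcal L_{X|Y}\cap\mathcal H_{X|Z}$ and $\mathcal B^{(s)}=\mathcal H_X\cap\mathcal L_{X|Y}^c\cap\mathcal H_{X|Z}^c$. Assume that for all sufficiently large $N$ there are sets $\mathcal E^{(s)}\subseteq\mathcal I^{(s)}$ with $|\mathcal E^{(s)}|=\max_{s'\in\mathcal S}|\mathcal B^{(s')}|$ for every $s$, and fix such sets. *Scheme.* After $\omega$ pre-learning rounds there are $t$ secure rounds with actual states $s_1,\dots,s_t$.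 In round $i$ the users compute, by an arbitrary learning map, an estimate $\hat\lambda_i$ of $\lambda$ from the observations of the pre-learning rounds and of the secure rounds $1,\dots,i$, decode from these observations and $\hat\lambda_i$, by an arbitrary decoding map, a sequence of $i$ states, and use its last entry $\hat s_i$. They send message bits on $\hat{\mathcal I}_i\setminus\hat{\mathcal E}_i$, where $\hat{\mathcal I}_i=\mathcal I^{(\hat s_i)}$, $\hat{\mathcal E}_i=\mathcal E^{(\hat s_i)}$. Let $t(\vee)=\{i:\hat s_i=s_i\}$ and $t(\wedge)=\{i:\hat s_i\neq s_i\}$, with $t_\vee$ and $t_\wedge$ elements, let $\xi_i=(\hat{\mathcal I}_i\setminus\hat{\mathcal E}_i)\cap\mathcal I^{(s_i)}$, and define the secrecy rate and the average secrecy capacity of the matched rounds as $$\mathbf R_s(t)=\frac1{Nt}\Big(\sum_{i\in t(\vee)}|\hat{\mathcal I}_i\setminus\hat{\mathcal E}_i|+\sum_{i\in t(\wedge)}|\xi_i|\Big),\qquad \bar{\mathrm C}_{s\text{-}t(\vee)}=\frac1{t_\vee}\sum_{i\in t(\vee)}\mathrm C_s(s_i)$$ (both read as $0$ when the denominator is $0$).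 Then: 1. For every $\varepsilon>0$ there is $N_0$ such that for all $N=2^n\ge N_0$, all $t$ and all sequences of actual and estimated states, $$\mathbf R_s(t)\le\bar{\mathrm C}_{s\text{-}t(\vee)}+\frac1t\sum_{i\in t(\wedge)}\frac{|\xi_i|}N+\varepsilon .$$ 2. Suppose that, along some way of letting $\omega+t\to\infty$ (with $t\ge1$), the mismatched rounds disappear in the sense that $t_\wedge/t\to0$ in probability. Then for every $\varepsilon>0$ the probability that $t_\vee\ge1$ and $\mathbf R_s(t)\le\bar{\mathrm C}_{s\text{-}t(\vee)}+\varepsilon$ tends to $1$ as $\omega+t\to\infty$ in this way and, jointly, $N\to\infty$. 3. Whenever $t_\vee\ge1$, $\bar{\mathrm C}_{s\text{-}t(\vee)}\ge\min_{\mathcal S}\mathrm C_s$, with strict inequality if and only if $\mathrm C_s(s_i)>\min_{\mathcal S}\mathrm C_s$ for some $i\in t(\vee)$. 4. The rates achievable in the definition of $\mathrm C_{us}$ are bounded above, and $\mathrm C_{us}\le\min_{\mathcal S}\mathrm C_s$; thus $\bar{\mathrm C}_{s\text{-}t(\vee)}$ is at least this upper bound on the universal secrecy capacity. -/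

import Mathlib

open Filter Topology

namespace GVWTC

noncomputable section

/-! ### Random variables on a finite probability space

A probability mass function on a finite set `Ω` is given by `p : Ω → ℝ`, and random variables are
functions on `Ω`. -/

open scoped Classical in
/-- The law of the random variable `f` under the mass function `p`. -/
def law {Ω α : Type*} [Fintype Ω] (p : Ω → ℝ) (f : Ω → α) (a : α) : ℝ :=
  ∑ w, if f w = a then p w else 0

/-- Shannon entropy `H(f)` in bits. -/
def entropy {Ω α : Type*} [Fintype Ω] [Fintype α] (p : Ω → ℝ) (f : Ω → α) : ℝ :=
  ∑ a, Real.negMulLog (law p f a) / Real.log 2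

/-- Mutual information `I(f; g) = H(f) + H(g) - H(f, g)` in bits. -/
def mutualInfo {Ω α γ : Type*} [Fintype Ω] [Fintype α] [Fintype γ]
    (p : Ω → ℝ) (f : Ω → α) (g : Ω → γ) : ℝ :=
  entropy p f + entropy p g - entropy p (fun w => (f w, g w))

/-- The Bhattacharyya parameter
`Z(f | g) = 2 ∑_c p(g = c) √(p(f = 0 | g = c) p(f = 1 | g = c))` of a binary random variable `f`
given `g` (terms with `p(g = c) = 0` vanish). -/
def bhattacharyya {Ω γ : Type*} [Fintype Ω] [Fintype γ]
    (p : Ω → ℝ) (f : Ω → ZMod 2) (g : Ω → γ) : ℝ :=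
  2 * ∑ c, law p g c *
    √((law p (fun w => (f w, g w)) (0, c) / law p g c) *
      (law p (fun w => (f w, g w)) (1, c) / law p g c))

/-! ### Wiretap channels and the secrecy capacity of one state -/

/-- A discrete memoryless wiretap channel `p_{YZ|X}` (one state of the eavesdropper). -/
abbrev Channel (X Y Z : Type*) [Fintype Y] [Fintype Z] := X → stdSimplex ℝ (Y × Z)

/-- The set of all values `I(U;Y) - I(U;Z)`, for `U` with finite alphabet such that
`U → X → (Y, Z)` is a Markov chain whose second transition is `W`. -/
def secrecyRates {X Y Z : Type*} [Fintype X] [Fintype Y] [Fintype Z] (W : Channel X Y Z) : Set ℝ :=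
  {r | ∃ (k : ℕ) (q : stdSimplex ℝ (Fin k × X)),
    r = mutualInfo (fun w : (Fin k × X) × (Y × Z) => q w.1 * W w.1.2 w.2)
          (fun w => w.1.1) (fun w => w.2.1)
      - mutualInfo (fun w : (Fin k × X) × (Y × Z) => q w.1 * W w.1.2 w.2)
          (fun w => w.1.1) (fun w => w.2.2)}

/-- Secrecy capacity `C_s = max_{U → X → (Y, Z)} [I(U;Y) - I(U;Z)]`. -/
def secrecyCapacity {X Y Z : Type*} [Fintype X] [Fintype Y] [Fintype Z] (W : Channel X Y Z) : ℝ :=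
  sSup (secrecyRates W)

/-- `min_S C_s`. -/
def minSecrecyCapacity {St X Y Z : Type*} [Fintype St] [Nonempty St] [Fintype X] [Fintype Y]
    [Fintype Z] (W : St → Channel X Y Z) : ℝ :=
  Finset.univ.inf' Finset.univ_nonempty fun s => secrecyCapacity (W s)

/-! ### The universal (compound) secrecy capacity -/

/-- A wiretap code of block length `N` with `K` messages: a stochastic encoder and a decoder that
may declare an error (`none`). -/
structure WiretapCode (X Y : Type*) [Fintype X] (N K : ℕ) where
  enc : Fin K → stdSimplex ℝ (Fin N → X)
  dec : (Fin N → Y) → Option (Fin K)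

/-- The joint law of a uniform message `M`, the codeword `X^N` and the outputs `(Y^N, Z^N)` when
the code is used over `W`. -/
def WiretapCode.joint {X Y Z : Type*} [Fintype X] [Fintype Y] [Fintype Z] {N K : ℕ}
    (c : WiretapCode X Y N K) (W : Channel X Y Z) :
    Fin K × (Fin N → X) × (Fin N → Y × Z) → ℝ :=
  fun w => (1 / (K : ℝ)) * c.enc w.1 w.2.1 * ∏ j, W (w.2.1 j) (w.2.2 j)

open scoped Classical in
/-- The error probability `Pr(M ≠ M̂)`. -/
def WiretapCode.errorProb {X Y Z : Type*} [Fintype X] [Fintype Y] [Fintype Z] {N K : ℕ}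
    (c : WiretapCode X Y N K) (W : Channel X Y Z) : ℝ :=
  ∑ w : Fin K × (Fin N → X) × (Fin N → Y × Z),
    if c.dec (fun j => (w.2.2 j).1) ≠ some w.1 then c.joint W w else 0

/-- The information leakage `I(Z^N; M)`. -/
def WiretapCode.leakage {X Y Z : Type*} [Fintype X] [Fintype Y] [Fintype Z] {N K : ℕ}
    (c : WiretapCode X Y N K) (W : Channel X Y Z) : ℝ :=
  mutualInfo (c.joint W) (fun w => fun j => (w.2.2 j).2) (fun w => w.1)

/-- The rates `R` achievable by codes that do not depend on the state and that are reliable and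
strongly secure for every state. -/
def universalRates {St X Y Z : Type*} [Fintype X] [Fintype Y] [Fintype Z]
    (W : St → Channel X Y Z) : Set ℝ :=
  {R | ∃ c : (N : ℕ) → WiretapCode X Y N ⌈(2 : ℝ) ^ ((N : ℝ) * R)⌉₊,
    ∀ s, Tendsto (fun N => (c N).errorProb (W s)) atTop (𝓝 0) ∧
      Tendsto (fun N => (c N).leakage (W s)) atTop (𝓝 0)}

/-- The universal secrecy capacity `C_us`. -/
def universalSecrecyCapacity {St X Y Z : Type*} [Fintype X] [Fintype Y] [Fintype Z]
    (W : St → Channel X Y Z) : ℝ :=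
  sSup (universalRates W)

/-! ### Polarization -/

/-- The Kronecker power `F^{⊗n}` of `F = [1 0; 1 1]`. -/
def kroneckerPow : (n : ℕ) → Matrix (Fin (2 ^ n)) (Fin (2 ^ n)) (ZMod 2)
  | 0 => 1
  | n + 1 =>
    let e : Fin 2 × Fin (2 ^ n) ≃ Fin (2 ^ (n + 1)) :=
      finProdFinEquiv.trans (finCongr (pow_succ' 2 n).symm)
    Matrix.reindex e e (Matrix.kroneckerMap (· * ·) !![1, 0; 1, 1] (kroneckerPow n))

/-- The bit reversal permutation matrix. -/
def bitReversal (n : ℕ) : Matrix (Fin (2 ^ n)) (Fin (2 ^ n)) (ZMod 2) :=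
  fun i j => if j = (BitVec.ofFin i).reverse.toFin then 1 else 0

/-- The generator matrix `G_N = R F^{⊗n}`, `N = 2 ^ n`. -/
def polarMatrix (n : ℕ) : Matrix (Fin (2 ^ n)) (Fin (2 ^ n)) (ZMod 2) :=
  bitReversal n * kroneckerPow n

/-- The law of `N` independent uses of the channel `W` with inputs drawn from `Q`; a point of the
space is the sequence of the triples `(x_j, (y_j, z_j))`. -/
def blockLaw {X Y Z : Type*} [Fintype X] [Fintype Y] [Fintype Z]
    (Q : stdSimplex ℝ X) (W : Channel X Y Z) (N : ℕ) (v : Fin N → X × Y × Z) : ℝ :=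
  ∏ j, Q (v j).1 * W (v j).1 (v j).2

/-- The polarized vector `U^N = X^N G_N` (so `X^N = U^N G_N`, as `G_N` is its own inverse). -/
def polarU {Y Z : Type*} (n : ℕ) (v : Fin (2 ^ n) → ZMod 2 × Y × Z) : Fin (2 ^ n) → ZMod 2 :=
  Matrix.vecMul (fun j => (v j).1) (polarMatrix n)

/-- `Z(U_j | U_1^{j-1}, g)` for the side information `g`. -/
def polarZ {Y Z γ : Type*} [Fintype Y] [Fintype Z] [Fintype γ]
    (Q : stdSimplex ℝ (ZMod 2)) (W : Channel (ZMod 2) Y Z) (n : ℕ)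
    (g : (Fin (2 ^ n) → ZMod 2 × Y × Z) → γ) (j : Fin (2 ^ n)) : ℝ :=
  bhattacharyya (blockLaw Q W (2 ^ n)) (fun v => polarU n v j)
    (fun v => ((fun i : Fin j.val => polarU n v (i.castLE j.isLt.le)), g v))

/-- `δ_N = 2^{-N^β}`, `N = 2 ^ n`. -/
def polarDelta (β : ℝ) (n : ℕ) : ℝ := (2 : ℝ) ^ (-(((2 ^ n : ℕ) : ℝ) ^ β))

open scoped Classical in
/-- Indices with `Z(U_j | U_1^{j-1}, g) ≥ 1 - δ_N`. -/
def highSet {Y Z γ : Type*} [Fintype Y] [Fintype Z] [Fintype γ] (β : ℝ)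
    (Q : stdSimplex ℝ (ZMod 2)) (W : Channel (ZMod 2) Y Z) (n : ℕ)
    (g : (Fin (2 ^ n) → ZMod 2 × Y × Z) → γ) : Finset (Fin (2 ^ n)) :=
  {j | 1 - polarDelta β n ≤ polarZ Q W n g j}

open scoped Classical in
/-- Indices with `Z(U_j | U_1^{j-1}, g) ≤ δ_N`. -/
def lowSet {Y Z γ : Type*} [Fintype Y] [Fintype Z] [Fintype γ] (β : ℝ)
    (Q : stdSimplex ℝ (ZMod 2)) (W : Channel (ZMod 2) Y Z) (n : ℕ)
    (g : (Fin (2 ^ n) → ZMod 2 × Y × Z) → γ) : Finset (Fin (2 ^ n)) :=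
  {j | polarZ Q W n g j ≤ polarDelta β n}

section IndexSets

variable {Y Z : Type*} [Fintype Y] [Fintype Z] (β : ℝ) (Q : stdSimplex ℝ (ZMod 2))
  (W : Channel (ZMod 2) Y Z) (n : ℕ)

/-- `H_X` (no side information). -/
def setHX : Finset (Fin (2 ^ n)) := highSet β Q W n (fun _ => ())

/-- `L_{X|Y}` (side information `Y^N`). -/
def setLXY : Finset (Fin (2 ^ n)) := lowSet β Q W n (fun v => fun j => (v j).2.1)

/-- `H_{X|Z}` (side information `Z^N`). -/
def setHXZ : Finset (Fin (2 ^ n)) := highSet β Q W n (fun v => fun j => (v j).2.2)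

/-- Secure and reliable indices `I = H_X ∩ L_{X|Y} ∩ H_{X|Z}`. -/
def setI : Finset (Fin (2 ^ n)) := setHX β Q W n ∩ setLXY β Q W n ∩ setHXZ β Q W n

/-- Insecure and unreliable indices `B = H_X ∩ (L_{X|Y})ᶜ ∩ (H_{X|Z})ᶜ`. -/
def setB : Finset (Fin (2 ^ n)) := setHX β Q W n ∩ (setLXY β Q W n)ᶜ ∩ (setHXZ β Q W n)ᶜ

end IndexSets

/-- `max_S |B|`. -/
def maxB {St Y Z : Type*} [Fintype St] [Fintype Y] [Fintype Z] (β : ℝ)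
    (Q : St → stdSimplex ℝ (ZMod 2)) (W : St → Channel (ZMod 2) Y Z) (n : ℕ) : ℕ :=
  Finset.univ.sup fun s => (setB β (Q s) (W s) n).card

/-! ### The `t` rounds: matched and mismatched rounds, rate, average secrecy capacity -/

open scoped Classical in
/-- The rounds `t(∨)` in which the estimated state `s'` matches the actual state `s`. -/
def matched {St : Type*} {t : ℕ} (s s' : Fin t → St) : Finset (Fin t) := {i | s' i = s i}

open scoped Classical in
/-- The rounds `t(∧)` in which the estimated state does not match the actual one. -/
def mismatched {St : Type*} {t : ℕ} (s s' : Fin t → St) : Finset (Fin t) := {i | s' i ≠ s i}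

/-- `ξ_i = (Î_i \ Ê_i) ∩ I_i`, where the hatted sets belong to the estimated state `s'` and the
others to the actual state `s`. -/
def setXi {St : Type*} {N : ℕ} (I E : St → Finset (Fin N)) (s s' : St) : Finset (Fin N) :=
  (I s' \ E s') ∩ I s

/-- The contribution `(1 / t) ∑_{t(∧)} |ξ_i| / N` of the mismatched rounds. -/
def mismatchTerm {St : Type*} {N t : ℕ} (I E : St → Finset (Fin N)) (s s' : Fin t → St) : ℝ :=
  (1 / (t : ℝ)) * ∑ i ∈ mismatched s s', ((setXi I E (s i) (s' i)).card : ℝ) / N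

/-- The secrecy rate of `t` rounds,
`R_s(t) = (1 / (N t)) (∑_{t(∨)} |Î_i \ Ê_i| + ∑_{t(∧)} |ξ_i|)`: the number of message bits per
channel use that are sent securely and reliably. -/
def secrecyRate {St : Type*} {N t : ℕ} (I E : St → Finset (Fin N)) (s s' : Fin t → St) : ℝ :=
  (1 / ((N : ℝ) * t)) *
    (∑ i ∈ matched s s', ((I (s' i) \ E (s' i)).card : ℝ) +
      ∑ i ∈ mismatched s s', ((setXi I E (s i) (s' i)).card : ℝ))

/-- The average `(1 / t_∨) ∑_{t(∨)} C_s(s_i)` over the matched rounds. -/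
def avgMatchedCapacity {St X Y Z : Type*} [Fintype X] [Fintype Y] [Fintype Z]
    (W : St → Channel X Y Z) {t : ℕ} (s s' : Fin t → St) : ℝ :=
  (1 / ((matched s s').card : ℝ)) * ∑ i ∈ matched s s', secrecyCapacity (W (s i))

/-! ### Hidden Markov model of the states, learning and state decoding -/

/-- Parameters `λ = (A, B, π)` of a hidden Markov model with states `St`, observations `Ob`. -/
structure HMM (St Ob : Type*) [Fintype St] [Fintype Ob] where
  trans : St → stdSimplex ℝ St
  emit : St → stdSimplex ℝ Ob
  init : stdSimplex ℝ St

/-- The probability of the state sequence `s` together with the observation sequence `o`. -/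
def HMM.pathProb {St Ob : Type*} [Fintype St] [Fintype Ob] (l : HMM St Ob) {T : ℕ}
    (s : Fin T → St) (o : Fin T → Ob) : ℝ :=
  ∏ k : Fin T,
    (if k.val = 0 then l.init (s k) else l.trans (s ⟨k.val - 1, by omega⟩) (s k)) *
      l.emit (s k) (o k)

open scoped Classical in
/-- The probability of an event that depends on the first `T` states and observations. -/
def HMM.prob {St Ob : Type*} [Fintype St] [Fintype Ob] (l : HMM St Ob) {T : ℕ}
    (P : (Fin T → St) → (Fin T → Ob) → Prop) : ℝ :=
  ∑ s : Fin T → St, ∑ o : Fin T → Ob, if P s o then l.pathProb s o else 0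

/-- A learning process `λ̂ = 𝕃(o_ω, o_1^i)`. -/
abbrev Learner (St Ob : Type*) [Fintype St] [Fintype Ob] :=
  (ω i : ℕ) → (Fin ω → Ob) → (Fin i → Ob) → HMM St Ob

/-- A state decoding process `ŝ_1^i = 𝔻(o_ω, o_1^i, λ̂)`. -/
abbrev StateDecoder (St Ob : Type*) [Fintype St] [Fintype Ob] :=
  (ω i : ℕ) → (Fin ω → Ob) → (Fin i → Ob) → HMM St Ob → (Fin i → St)

/-- The actual states of the `t` secure rounds; they follow the `ω` rounds of pre-learning. -/
def secureStates {St : Type*} {ω t : ℕ} (s : Fin (ω + t) → St) : Fin t → St :=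
  fun i => s (i.natAdd ω)

/-- The states estimated by the legitimate users: in each secure round the last entry of the
sequence decoded from all observations up to and including that round. -/
def estimatedStates {St Ob : Type*} [Fintype St] [Fintype Ob]
    (𝕃 : Learner St Ob) (𝔻 : StateDecoder St Ob) {ω t : ℕ} (o : Fin (ω + t) → Ob) :
    Fin t → St := fun i =>
  let pre : Fin ω → Ob := fun k => o (k.castAdd t)
  let obs : Fin (i.val + 1) → Ob := fun k => o ((k.castLE i.isLt).natAdd ω)
  𝔻 ω (i.val + 1) pre obs (𝕃 ω (i.val + 1) pre obs) (Fin.last i.val)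

end

end GVWTC

open GVWTC

namespace GVWTC

/-! ### Averages over the descendants of a vertex in a binary tree -/

/-! The rate bounds rest on one estimate per state: for every ε and all large N, |I| - |B| ≤ N
(H(X|Z) - H(X|Y) + ε). As |E| ≥ |B|, the same bound holds for |I \ E|, and H(X|Z) - H(X|Y) = I(X;Y)
- I(X;Z) is the value of the choice U = X in the definition of the secrecy capacity. Averaging over
the matched rounds gives the rate bound; replacing 1/t by 1/t_∨ costs nothing because capacities are
nonnegative.

The estimate counts indices by their conditional entropies. Set algebra gives |I| - |B| ≤ |H_{X|Z}|
- |H_X \ L_{X|Y}| (`card_setI_sub_card_setB_le`). The polar transform conserves total entropy, and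
an index of H_{X|Z} carries almost one bit, so there are at most about N H(X|Z) of them. Conversely
the entropy N H(X|Y) has to sit somewhere: almost none is on L_{X|Y}, and almost none outside H_X,
because even without side information the entropy there is o(N). Hence H_X \ L_{X|Y} has at least
about N H(X|Y) elements.

Only the claim about the complement of H_X needs polarization, in its fast form. It is proved for
the total variation T = ∑ |p(0,b) - p(1,b)| instead of the Bhattacharyya parameter: one step of the
transform turns T into exactly T² and into at most 2T - T², and T ≤ δ forces Z ≥ 1 - δ
(`exists_treeAvg_fast`, `BinSource.eventually_ent_le`).

The bound on the universal secrecy capacity is a converse for wiretap codes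
(`WiretapCode.converse`). The eavesdropper's outputs are exchanged for the legitimate ones position
by position. Given all other outputs, the message is an admissible auxiliary variable for the
channel at that position, so each exchange raises the information about the message by at most C_s.
Fano's inequality finishes the argument. -/

theorem pow_div_pow_le_exp {κ : ℝ} {m n a : ℕ} (hκ0 : 0 < κ) (hκ1 : κ < 1)
    (hm : (1 - κ) * n ≤ m) (ha : (a : ℝ) ≤ (1 / 2 - 2 * κ) * n + 1) :
    ((1 + (1 - κ)) / 2) ^ m / (1 - κ) ^ a ≤ Real.exp (κ / (1 - κ) * (1 - κ * n)) := by
  have h1 : 0 < 1 - κ := by linarith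
  have y1 : (1 + (1 - κ)) / 2 ≤ Real.exp (-(κ / 2)) := by
    have := Real.add_one_le_exp (-(κ / 2))
    linarith
  have y2 : 1 / (1 - κ) ≤ Real.exp (κ / (1 - κ)) := by
    have := Real.add_one_le_exp (κ / (1 - κ))
    have e : 1 / (1 - κ) = κ / (1 - κ) + 1 := by field_simp; ring
    linarith
  have y3 : (0 : ℝ) ≤ (1 + (1 - κ)) / 2 := by linarith
  calc ((1 + (1 - κ)) / 2) ^ m / (1 - κ) ^ a = ((1 + (1 - κ)) / 2) ^ m * (1 / (1 - κ)) ^ a := by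
        rw [one_div_pow, mul_one_div]
    _ ≤ Real.exp (-(κ / 2)) ^ m * Real.exp (κ / (1 - κ)) ^ a := by gcongr
    _ = Real.exp (m * (-(κ / 2)) + a * (κ / (1 - κ))) := by
        rw [← Real.exp_nat_mul, ← Real.exp_nat_mul, Real.exp_add]
    _ ≤ _ := by
        apply Real.exp_le_exp.2
        have hq : 0 < κ / (1 - κ) := div_pos hκ0 h1
        have m2 : (1 - κ) * ((1 - κ) * n) ≤ (1 - κ) * m :=
          mul_le_mul_of_nonneg_left hm h1.le
        have e : (m : ℝ) * (-(κ / 2)) = κ / (1 - κ) * (-((1 - κ) * m / 2)) := by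
          field_simp
        rw [e, mul_comm (a : ℝ), ← mul_add]
        apply mul_le_mul_of_nonneg_left _ hq.le
        -- Up to the factor κ / (1 - κ), the exponent is at most (1/2 - 2κ) n + 1 - (1 - κ)² n / 2 =
        -- 1 - κ n - κ² n / 2; the last term is dropped.
        have e2 : (1 - κ) * ((1 - κ) * (n : ℝ)) = n - 2 * (κ * n) + κ ^ 2 * n := by ring
        have e3 : (1 / 2 - 2 * κ) * (n : ℝ) = n / 2 - 2 * (κ * n) := by ring
        have e4 : 0 ≤ κ ^ 2 * n := by positivity
        linarith

section Tree

variable {S : Type*} (l r : S → S)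

/-- The average of `f` over the `2 ^ n` descendants of generation `n` of `s`, where every vertex `s`
has the children `l s` and `r s`. -/
noncomputable def treeAvg : ℕ → (S → ℝ) → S → ℝ
  | 0, f, s => f s
  | n + 1, f, s => (treeAvg n f (l s) + treeAvg n f (r s)) / 2

theorem treeAvg_mono {f g : S → ℝ} (h : ∀ s, f s ≤ g s) (n : ℕ) (s : S) :
    treeAvg l r n f s ≤ treeAvg l r n g s := by
  induction n generalizing s with
  | zero => exact h s
  | succ n ih => simp only [treeAvg]; linarith [ih (l s), ih (r s)]

theorem treeAvg_add (f g : S → ℝ) (n : ℕ) (s : S) :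
    treeAvg l r n (fun s => f s + g s) s = treeAvg l r n f s + treeAvg l r n g s := by
  induction n generalizing s with
  | zero => rfl
  | succ n ih => simp only [treeAvg, ih]; ring

theorem treeAvg_const_mul (c : ℝ) (f : S → ℝ) (n : ℕ) (s : S) :
    treeAvg l r n (fun s => c * f s) s = c * treeAvg l r n f s := by
  induction n generalizing s with
  | zero => rfl
  | succ n ih => simp only [treeAvg, ih]; ring

theorem treeAvg_const (c : ℝ) (n : ℕ) (s : S) : treeAvg l r n (fun _ => c) s = c := by
  induction n generalizing s with
  | zero => rfl
  | succ n ih => simp only [treeAvg, ih]; ring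

theorem treeAvg_comp (f : S → ℝ) (m n : ℕ) (s : S) :
    treeAvg l r (m + n) f s = treeAvg l r m (treeAvg l r n f) s := by
  induction m generalizing s with
  | zero => simp [treeAvg]
  | succ m ih => rw [Nat.succ_add]; simp only [treeAvg, ih]

theorem treeAvg_nonneg {f : S → ℝ} (h : ∀ s, 0 ≤ f s) (n : ℕ) (s : S) :
    0 ≤ treeAvg l r n f s := by
  have := treeAvg_mono l r h n s
  rwa [treeAvg_const] at this

theorem treeAvg_eq_of_martingale {f : S → ℝ} (h : ∀ s, f (l s) + f (r s) = 2 * f s) (n : ℕ)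
    (s : S) : treeAvg l r n f s = f s := by
  induction n generalizing s with
  | zero => rfl
  | succ n ih => simp only [treeAvg, ih]; linarith [h s]

variable {l r} {T : S → ℝ} (h0 : ∀ s, 0 ≤ T s) (h1 : ∀ s, T s ≤ 1)
  (hl : ∀ s, T (l s) = T s ^ 2) (hr : ∀ s, T (r s) ≤ 2 * T s - T s ^ 2)

include h0 h1 hl hr

/-- Polarization: on average, `T` is close to `0` or to `1`. -/
theorem tendsto_treeAvg_polarization (s : S) :
    Tendsto (fun n => treeAvg l r n (fun s => (T s * (1 - T s)) ^ 2) s) atTop (𝓝 0) := by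
  set d : S → ℝ := fun s => (T s * (1 - T s)) ^ 2
  have hd : ∀ n, 0 ≤ treeAvg l r n d s := fun n => treeAvg_nonneg l r (fun s => sq_nonneg _) n s
  -- The potential 2T - T² = 1 - (1 - T)² is increasing on [0, 1]. If `T (r s)` takes its largest
  -- value 2T - T², the mean of the potential over the two children is smaller by exactly (T (1 -
  -- T))². Hence the averages of `d` telescope and are summable.
  have step : ∀ n, treeAvg l r (n + 1) (fun s => 2 * T s - T s ^ 2) s + treeAvg l r n d s ≤
      treeAvg l r n (fun s => 2 * T s - T s ^ 2) s := by
    intro n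
    rw [treeAvg_comp, ← treeAvg_add]
    refine treeAvg_mono l r (fun s => ?_) n s
    simp only [treeAvg, hl, d]
    have a0 := h0 (r s)
    have a1 := h0 s
    have a2 := h1 s
    nlinarith [hr s, h1 (r s), mul_nonneg (sub_nonneg.2 (hr s)) (sub_nonneg.2 (h1 (r s))),
      mul_nonneg (sub_nonneg.2 (hr s)) (sq_nonneg (1 - T s))]
  have tel : ∀ n, ∑ i ∈ Finset.range n, treeAvg l r i d s +
      treeAvg l r n (fun s => 2 * T s - T s ^ 2) s ≤ 2 * T s - T s ^ 2 := by
    intro n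
    induction n with
    | zero => simp [treeAvg]
    | succ n ih => rw [Finset.sum_range_succ]; linarith [step n]
  refine (summable_of_sum_range_le (c := 1) hd fun n => ?_).tendsto_atTop_zero
  have := treeAvg_nonneg l r (f := fun s => 2 * T s - T s ^ 2)
    (fun s => by nlinarith [h0 s, h1 s]) n s
  nlinarith [tel n, sq_nonneg (1 - T s)]

omit h1 in
open scoped Classical in
-- A maximal inequality combined with a moment bound. `T` is a supermartingale, so T / z pays for
-- the paths that ever exceed `z`. As long as T ≤ z, the children have at most z T and 2 T, so the
-- mean of T ^ α contracts by (2 ^ α + z ^ α) / 2, and Markov's inequality applies.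
theorem treeAvg_exceed_le {z α τ : ℝ} (hz : 0 < z) (hα : 0 < α) (hτ : 0 < τ) (k : ℕ) (s : S) :
    treeAvg l r k (fun s => if τ < T s then 1 else 0) s ≤
      T s / z + (((2 : ℝ) ^ α + z ^ α) / 2) ^ k * (T s ^ α / τ ^ α) := by
  have hθ : 0 ≤ ((2 : ℝ) ^ α + z ^ α) / 2 := by positivity
  have hnn : ∀ k s, 0 ≤ (((2 : ℝ) ^ α + z ^ α) / 2) ^ k * (T s ^ α / τ ^ α) := fun k s =>
    mul_nonneg (pow_nonneg hθ k) (div_nonneg (Real.rpow_nonneg (h0 s) _) (by positivity))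
  induction k generalizing s with
  | zero =>
    have hd : 0 ≤ T s / z := div_nonneg (h0 s) hz.le
    simp only [treeAvg, pow_zero, one_mul]
    split_ifs with h
    · have : 1 ≤ T s ^ α / τ ^ α := by
        rw [one_le_div (by positivity)]
        exact Real.rpow_le_rpow hτ.le h.le hα.le
      linarith
    · have := hnn 0 s
      rw [pow_zero, one_mul] at this
      linarith
  | succ k ih =>
    by_cases hs : z < T s
    · have : 1 ≤ T s / z := by rw [one_le_div hz]; exact hs.le
      have h2 : treeAvg l r (k + 1) (fun s => if τ < T s then (1 : ℝ) else 0) s ≤ 1 := by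
        have := treeAvg_mono l r (f := fun s => if τ < T s then (1 : ℝ) else 0) (g := fun _ => 1)
          (fun s => by split_ifs <;> norm_num) (k + 1) s
        rwa [treeAvg_const] at this
      linarith [hnn (k + 1) s]
    · push Not at hs
      have i1 := ih (l s)
      have i2 := ih (r s)
      have e1 : T (l s) / z + T (r s) / z ≤ 2 * (T s / z) := by
        rw [← add_div, mul_div_assoc']
        gcongr
        linarith [hl s, hr s]
      have e2 : T (l s) ^ α ≤ z ^ α * T s ^ α := by
        rw [hl, pow_two, Real.mul_rpow (h0 s) (h0 s)]
        exact mul_le_mul_of_nonneg_right (Real.rpow_le_rpow (h0 s) hs hα.le)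
          (Real.rpow_nonneg (h0 s) _)
      have e3 : T (r s) ^ α ≤ 2 ^ α * T s ^ α := by
        rw [← Real.mul_rpow (by norm_num) (h0 s)]
        exact Real.rpow_le_rpow (h0 _) (by nlinarith [hr s, sq_nonneg (T s)]) hα.le
      have e4 : (((2 : ℝ) ^ α + z ^ α) / 2) ^ k * (T (l s) ^ α / τ ^ α) +
          (((2 : ℝ) ^ α + z ^ α) / 2) ^ k * (T (r s) ^ α / τ ^ α) ≤
          2 * ((((2 : ℝ) ^ α + z ^ α) / 2) ^ (k + 1) * (T s ^ α / τ ^ α)) := by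
        rw [← mul_add, ← add_div, pow_succ]
        have : 2 * ((((2 : ℝ) ^ α + z ^ α) / 2) ^ k * (((2 : ℝ) ^ α + z ^ α) / 2) *
            (T s ^ α / τ ^ α)) = (((2 : ℝ) ^ α + z ^ α) / 2) ^ k *
            ((z ^ α * T s ^ α + 2 ^ α * T s ^ α) / τ ^ α) := by ring
        rw [this]
        gcongr
      simp only [treeAvg]
      linarith

omit h1 in
open scoped Classical in
-- A left step doubles the exponent of the bound on `T`, and a right step lowers it by one; the
-- factor 1 + k, which counts the remaining steps, absorbs all these losses. So `T` ends above 2 ^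
-- (-2 ^ a) only if `q` plus the number of left steps is less than `a`, and the right side is the
-- Chernoff bound with weight `x` per left step.
theorem treeAvg_doubly_exp_exceed_le {x : ℝ} (hx0 : 0 < x) (hx1 : x ≤ 1) (a : ℕ) (k q : ℕ) (s : S)
    (hs : T s ≤ (2 : ℝ) ^ (-((2 : ℝ) ^ q * (1 + k)))) :
    treeAvg l r k (fun s => if (2 : ℝ) ^ (-(2 : ℝ) ^ a) < T s then 1 else 0) s ≤
      x ^ q * ((1 + x) / 2) ^ k / x ^ a := by
  induction k generalizing q s with
  | zero =>
    simp only [treeAvg]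
    split_ifs with h
    · have h3 := h.trans_le hs
      rw [Real.rpow_lt_rpow_left_iff (by norm_num)] at h3
      have h4 : (2 : ℝ) ^ q < 2 ^ a := by simpa using h3
      have h5 : q < a := (pow_lt_pow_iff_right₀ (by norm_num)).1 h4
      rw [one_le_div (by positivity)]
      simpa using pow_le_pow_of_le_one hx0.le hx1 h5.le
    · positivity
  | succ k ih =>
    have q1 : (1 : ℝ) ≤ 2 ^ q := one_le_pow₀ (by norm_num)
    have i1 := ih (q + 1) (l s) (by
      rw [hl]
      calc T s ^ 2 ≤ ((2 : ℝ) ^ (-((2 : ℝ) ^ q * (1 + (k + 1 : ℕ))))) ^ 2 :=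
            pow_le_pow_left₀ (h0 s) hs 2
        _ = (2 : ℝ) ^ (-((2 : ℝ) ^ q * (1 + (k + 1 : ℕ))) * (2 : ℕ)) := by
            rw [Real.rpow_mul_natCast (by norm_num)]
        _ ≤ _ := by
            apply Real.rpow_le_rpow_of_exponent_le (by norm_num)
            push_cast
            rw [pow_succ]
            nlinarith)
    have i2 := ih q (r s) (by
      calc T (r s) ≤ 2 * T s := by nlinarith [hr s, sq_nonneg (T s)]
        _ ≤ (2 : ℝ) ^ (1 : ℝ) * (2 : ℝ) ^ (-((2 : ℝ) ^ q * (1 + (k + 1 : ℕ)))) := by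
            rw [Real.rpow_one]; linarith
        _ = (2 : ℝ) ^ (1 + -((2 : ℝ) ^ q * (1 + (k + 1 : ℕ)))) := by
            rw [Real.rpow_add (by norm_num)]
        _ ≤ _ := by
            apply Real.rpow_le_rpow_of_exponent_le (by norm_num)
            push_cast
            nlinarith)
    simp only [treeAvg]
    have : x ^ q * ((1 + x) / 2) ^ (k + 1) / x ^ a = (x ^ (q + 1) * ((1 + x) / 2) ^ k / x ^ a +
        x ^ q * ((1 + x) / 2) ^ k / x ^ a) / 2 := by ring
    rw [this]
    linarith

open scoped Classical in
/-- Fast polarization: once `T` is small, it is doubly exponentially small at most of the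
descendants. -/
theorem exists_treeAvg_fast {β ε : ℝ} (hβ0 : 0 < β) (hβ1 : β < 1 / 2) (hε : 0 < ε) :
    ∃ z : ℝ, 0 < z ∧ ∀ᶠ n : ℕ in atTop, ∀ s, T s ≤ z →
      1 - ε ≤ treeAvg l r n
        (fun s => if T s ≤ (2 : ℝ) ^ (-(2 : ℝ) ^ (β * n)) then 1 else 0) s := by
  -- Thus β = 1/2 - 2κ: the required number β n of left steps stays below the typical n / 2 by a
  -- margin that pays for the initial phase and for the Chernoff bound with x = 1 - κ.
  set κ : ℝ := (1 - 2 * β) / 4 with hκ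
  have hκ0 : 0 < κ := by rw [hκ]; linarith
  have hκ1 : κ < 1 / 4 := by rw [hκ]; linarith
  -- The initial phase takes n / C ≤ κ n generations. The bound C ≥ 8 makes α = 1 / (2C) small
  -- enough for θ ≤ 3/5, hence θ √2 < 1.
  obtain ⟨C, hC⟩ := exists_nat_ge (max 8 (1 / κ))
  have hC8 : (8 : ℝ) ≤ C := (le_max_left _ _).trans hC
  have hCκ : 1 / κ ≤ C := (le_max_right _ _).trans hC
  have hC0 : 0 < C := by
    rcases Nat.eq_zero_or_pos C with h | h
    · rw [h] at hC8; norm_num at hC8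
    · exact h
  set α : ℝ := 1 / (2 * C) with hα
  have hα0 : 0 < α := by positivity
  have hα1 : α ≤ 1 / 16 := by
    rw [hα]; exact one_div_le_one_div_of_le (by norm_num) (by linarith)
  set ζ : ℝ := (1 / 10) ^ (2 * C) with hζ
  have hζ0 : 0 < ζ := by positivity
  have hζα : ζ ^ α = 1 / 10 := by
    rw [hζ, ← Real.rpow_natCast, ← Real.rpow_mul (by norm_num), hα]
    have : ((2 * C : ℕ) : ℝ) * (1 / (2 * C)) = 1 := by push_cast; field_simp
    rw [this, Real.rpow_one]
  set θ : ℝ := ((2 : ℝ) ^ α + ζ ^ α) / 2 with hθ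
  have h2α : (2 : ℝ) ^ α ≤ 1 + α := by
    have := rpow_one_add_le_one_add_mul_self (s := 1) (by norm_num) hα0.le (by linarith)
    norm_num at this
    linarith
  have hθ0 : 0 ≤ θ := by positivity
  have hθ1 : θ ≤ 3 / 5 := by rw [hθ, hζα]; linarith
  have hs2 : √2 ≤ 3 / 2 := by rw [Real.sqrt_le_left (by norm_num)]; norm_num
  have lim1 : Tendsto (fun n : ℕ => √2 * (θ * √2) ^ (n / C)) atTop (𝓝 0) := by
    have : Tendsto (fun k : ℕ => √2 * (θ * √2) ^ k) atTop (𝓝 (√2 * 0)) :=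
      (tendsto_pow_atTop_nhds_zero_of_lt_one (by positivity)
        (by nlinarith [Real.sqrt_nonneg 2])).const_mul _
    rw [mul_zero] at this
    exact this.comp (Nat.tendsto_div_const_atTop hC0.ne')
  have lim2 : Tendsto (fun n : ℕ => Real.exp (κ / (1 - κ) * (1 - κ * n))) atTop (𝓝 0) := by
    refine Real.tendsto_exp_atBot.comp ?_
    refine Tendsto.const_mul_atBot (div_pos hκ0 (by linarith)) ?_
    refine tendsto_atBot_add_const_left _ 1 (?_ : Tendsto (fun n : ℕ => -(κ * (n : ℝ))) atTop atBot)
    exact tendsto_neg_atTop_atBot.comp (tendsto_natCast_atTop_atTop.const_mul_atTop hκ0)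
  -- There are three sources of failure, each of size at most ε / 4: exceeding ζ, not reaching τ in
  -- the initial phase, and too few left steps afterwards.
  refine ⟨min 1 (ζ * (ε / 4)), by positivity, ?_⟩
  filter_upwards [lim1.eventually_lt_const (show 0 < ε / 4 by positivity),
    lim2.eventually_lt_const (show 0 < ε / 4 by positivity)] with n hn1 hn2 s hs
  set k := n / C with hk
  set m := n - k with hm
  have hkn : k ≤ n := Nat.div_le_self _ _
  have hkm : k + m = n := by omega
  set a := ⌈β * n⌉₊ with ha
  have ha1 : (a : ℝ) ≤ β * n + 1 := (Nat.ceil_lt_add_one (by positivity)).le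
  set x : ℝ := 1 - κ with hx
  have hx0 : 0 < x := by linarith
  -- The smallness that `treeAvg_doubly_exp_exceed_le` asks for with q = 0 and the remaining m
  -- generations. As m is about C k, τ ^ (-α) is only of order √2 ^ k and is beaten by θ ^ k.
  set τ : ℝ := (2 : ℝ) ^ (-(1 + m : ℝ)) with hτ
  have hτ0 : 0 < τ := by positivity
  have key : treeAvg l r n (fun s => if (2 : ℝ) ^ (-(2 : ℝ) ^ a) < T s then 1 else 0) s ≤
      T s / ζ + θ ^ k * (T s ^ α / τ ^ α) + ((1 + x) / 2) ^ m / x ^ a := by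
    conv_lhs => rw [← hkm]
    rw [treeAvg_comp]
    have e := treeAvg_mono l r
      (f := treeAvg l r m (fun s => if (2 : ℝ) ^ (-(2 : ℝ) ^ a) < T s then 1 else 0))
      (g := fun s => (if τ < T s then 1 else 0) + ((1 + x) / 2) ^ m / x ^ a) (fun s => by
        have hp : 0 ≤ ((1 + x) / 2) ^ m / x ^ a := by positivity
        split_ifs with h
        · have := treeAvg_mono l r (f := fun s => if (2 : ℝ) ^ (-(2 : ℝ) ^ a) < T s then (1 : ℝ)
            else 0) (g := fun _ => 1) (fun s => by split_ifs <;> norm_num) m s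
          rw [treeAvg_const] at this
          linarith
        · have := treeAvg_doubly_exp_exceed_le h0 hl hr hx0 (by linarith : x ≤ 1) a m 0 s
            (by push Not at h; rw [pow_zero, one_mul]; exact h)
          simpa using this) k s
    rw [treeAvg_add, treeAvg_const] at e
    linarith [treeAvg_exceed_le h0 hl hr hζ0 hα0 hτ0 k s]
  have b1 : T s / ζ ≤ ε / 4 := by
    rw [div_le_iff₀ hζ0, mul_comm]
    exact hs.trans (min_le_right _ _)
  have b2 : θ ^ k * (T s ^ α / τ ^ α) ≤ √2 * (θ * √2) ^ k := by
    have t1 : T s ^ α ≤ 1 := Real.rpow_le_one (h0 s) (h1 s) hα0.le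
    have t2 : 1 / τ ^ α ≤ √2 * √2 ^ k := by
      rw [hτ, ← Real.rpow_mul (by norm_num), one_div, ← Real.rpow_neg (by norm_num),
        ← pow_succ', ← Real.rpow_natCast, Real.sqrt_eq_rpow, ← Real.rpow_mul (by norm_num)]
      apply Real.rpow_le_rpow_of_exponent_le (by norm_num)
      have : n + 1 ≤ C * (k + 1) := by
        have := Nat.lt_mul_div_succ n hC0
        rw [← hk] at this
        exact this
      have h3 : (n : ℝ) + 1 ≤ C * (k + 1) := by exact_mod_cast this
      have h4 : (m : ℝ) ≤ n := by exact_mod_cast Nat.sub_le n k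
      rw [hα]
      push_cast
      have : (C : ℝ) ≠ 0 := by positivity
      calc -(-(1 + (m : ℝ)) * (1 / (2 * C))) = (1 + m) / (2 * C) := by ring
        _ ≤ (C * (k + 1)) / (2 * C) := by gcongr; linarith
        _ = _ := by field_simp
    calc θ ^ k * (T s ^ α / τ ^ α) ≤ θ ^ k * (1 / τ ^ α) := by gcongr
      _ ≤ θ ^ k * (√2 * √2 ^ k) := by gcongr
      _ = _ := by rw [mul_pow]; ring
  have b3 : ((1 + x) / 2) ^ m / x ^ a ≤ Real.exp (κ / (1 - κ) * (1 - κ * n)) := by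
    have hkC : (k : ℝ) ≤ κ * n := by
      have : (k : ℝ) ≤ n / C := Nat.cast_div_le
      refine this.trans ?_
      rw [div_le_iff₀ (by positivity)]
      have : 1 ≤ κ * C := by
        rw [div_le_iff₀ hκ0] at hCκ; linarith
      nlinarith [(Nat.cast_nonneg n : (0 : ℝ) ≤ n)]
    have hmr : (m : ℝ) = n - k := by rw [hm, Nat.cast_sub hkn]
    refine pow_div_pow_le_exp hκ0 (by linarith) ?_ ?_
    · rw [hmr]; linarith
    · have hβκ : β = 1 / 2 - 2 * κ := by rw [hκ]; ring
      rwa [hβκ] at ha1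
  have last : treeAvg l r n (fun s => if T s ≤ (2 : ℝ) ^ (-(2 : ℝ) ^ (β * n)) then 1 else 0) s +
      treeAvg l r n (fun s => if (2 : ℝ) ^ (-(2 : ℝ) ^ a) < T s then 1 else 0) s ≥ 1 := by
    rw [← treeAvg_add, ge_iff_le, ← treeAvg_const l r 1 n s]
    refine treeAvg_mono l r (fun s => ?_) n s
    rw [treeAvg_const]
    have : (2 : ℝ) ^ (-(2 : ℝ) ^ a) ≤ (2 : ℝ) ^ (-(2 : ℝ) ^ (β * n)) := by
      apply Real.rpow_le_rpow_of_exponent_le (by norm_num)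
      rw [neg_le_neg_iff, ← Real.rpow_natCast]
      exact Real.rpow_le_rpow_of_exponent_le (by norm_num) (Nat.le_ceil _)
    split_ifs with h h'
    · norm_num
    · norm_num
    · norm_num
    · exact absurd (le_trans (not_lt.1 ‹_›) this) h
  linarith

end Tree

/-! ### Binary sources with side information -/

/-- The contribution `|a - c|` of a symbol of the side information to the total variation. -/
def tvTerm (a c : ℝ) : ℝ := |a - c|

/-- The contribution `2 √(a c)` of a symbol of the side information to the Bhattacharyya
parameter. -/
noncomputable def bhatTerm (a c : ℝ) : ℝ := 2 * √(a * c)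

/-- The contribution of a symbol of the side information to the conditional entropy in nats. -/
noncomputable def entTerm (a c : ℝ) : ℝ :=
  Real.negMulLog a + Real.negMulLog c - Real.negMulLog (a + c)

theorem bhatTerm_zero : bhatTerm 0 0 = 0 := by simp [bhatTerm]

theorem entTerm_zero : entTerm 0 0 = 0 := by simp [entTerm]

/-- Here a + c - |a - c| = 2 min(a, c), and min(a, c) ≤ √(a c). -/
theorem le_tvTerm_add_bhatTerm {a c : ℝ} (ha : 0 ≤ a) (hc : 0 ≤ c) :
    a + c ≤ tvTerm a c + bhatTerm a c := by
  unfold tvTerm bhatTerm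
  rcases le_total a c with h | h
  · have : a ≤ √(a * c) := Real.le_sqrt_of_sq_le (by nlinarith)
    rw [abs_of_nonpos (by linarith)]; linarith
  · have : c ≤ √(a * c) := Real.le_sqrt_of_sq_le (by nlinarith)
    rw [abs_of_nonneg (by linarith)]; linarith

/-- From 4 a c = (a + c)² - (a - c)² ≤ 2 (a + c)(a + c - |a - c|) and the weighted
arithmetic-geometric mean inequality. The free weight κ makes the bound linear, so it can be summed
over the side information without Cauchy-Schwarz. -/
theorem bhatTerm_le {a c κ : ℝ} (ha : 0 ≤ a) (hc : 0 ≤ c) (hκ : 0 < κ) :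
    bhatTerm a c ≤ κ * (a + c) + (1 / (2 * κ)) * (a + c - tvTerm a c) := by
  unfold bhatTerm tvTerm
  have hs : 0 ≤ a + c - |a - c| := by
    rcases abs_cases (a - c) with h | h <;> linarith
  have e1 : 2 * √(a * c) = √(4 * (a * c)) := by
    rw [Real.sqrt_mul (by norm_num : (0 : ℝ) ≤ 4), show (4 : ℝ) = 2 ^ 2 by norm_num,
      Real.sqrt_sq (by norm_num)]
  rw [e1]
  apply Real.sqrt_le_iff.2
  refine ⟨by positivity, ?_⟩
  have e2 : 4 * (a * c) ≤ 2 * (a + c) * (a + c - |a - c|) := by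
    nlinarith [sq_abs (a - c), abs_nonneg (a - c), sq_nonneg (a + c - |a - c|)]
  have e3 : 2 * (a + c) * (a + c - |a - c|) =
      4 * ((κ * (a + c)) * ((1 / (2 * κ)) * (a + c - |a - c|))) := by field_simp; ring
  rw [e3] at e2
  nlinarith [sq_nonneg (κ * (a + c) - (1 / (2 * κ)) * (a + c - |a - c|))]

theorem entTerm_eq {a c : ℝ} (ha : 0 < a) (hc : 0 < c) :
    entTerm a c = a * Real.log ((a + c) / a) + c * Real.log ((a + c) / c) := by
  rw [Real.log_div (by positivity) ha.ne', Real.log_div (by positivity) hc.ne']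
  simp only [entTerm, Real.negMulLog]
  ring

theorem entTerm_zero_left (c : ℝ) : entTerm 0 c = 0 := by simp [entTerm]

theorem entTerm_zero_right (a : ℝ) : entTerm a 0 = 0 := by simp [entTerm]

theorem entTerm_nonneg {a c : ℝ} (ha : 0 ≤ a) (hc : 0 ≤ c) : 0 ≤ entTerm a c := by
  rcases ha.eq_or_lt with rfl | ha
  · rw [entTerm_zero_left]
  rcases hc.eq_or_lt with rfl | hc
  · rw [entTerm_zero_right]
  rw [entTerm_eq ha hc]
  have h1 : 0 ≤ Real.log ((a + c) / a) := Real.log_nonneg (by rw [one_le_div ha]; linarith)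
  have h2 : 0 ≤ Real.log ((a + c) / c) := Real.log_nonneg (by rw [one_le_div hc]; linarith)
  positivity

/-- Each of the two terms a log((a + c) / a) is at most 2 √(a c), by log t ≤ 2 (√t - 1) and √(a + c)
≤ √a + √c. -/
theorem entTerm_le_bhatTerm {a c : ℝ} (ha : 0 ≤ a) (hc : 0 ≤ c) :
    entTerm a c ≤ 2 * bhatTerm a c := by
  have hb : 0 ≤ bhatTerm a c := by unfold bhatTerm; positivity
  rcases ha.eq_or_lt with rfl | ha
  · rw [entTerm_zero_left]; linarith
  rcases hc.eq_or_lt with rfl | hc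
  · rw [entTerm_zero_right]; linarith
  have key : ∀ {a c : ℝ}, 0 < a → 0 < c → a * Real.log ((a + c) / a) ≤ 2 * √(a * c) := by
    intro a c ha hc
    have hsa := Real.sqrt_pos.2 ha
    have h1 : Real.log ((a + c) / a) ≤ 2 * (√((a + c) / a) - 1) := by
      have h := Real.log_le_sub_one_of_pos (x := √((a + c) / a))
        (Real.sqrt_pos.2 (by positivity))
      rw [Real.log_sqrt (by positivity)] at h
      linarith
    have h2 : √(a + c) ≤ √a + √c := by
      apply Real.sqrt_le_iff.2
      refine ⟨by positivity, ?_⟩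
      nlinarith [Real.sq_sqrt ha.le, Real.sq_sqrt hc.le, Real.sqrt_nonneg a, Real.sqrt_nonneg c,
        mul_nonneg (Real.sqrt_nonneg a) (Real.sqrt_nonneg c)]
    calc a * Real.log ((a + c) / a) ≤ a * (2 * (√((a + c) / a) - 1)) := by gcongr
      _ = 2 * (√a * (√(a + c) - √a)) := by
          rw [Real.sqrt_div (by positivity)]
          nth_rewrite 1 [← Real.mul_self_sqrt ha.le]
          field_simp
      _ ≤ 2 * (√a * √c) := by gcongr; linarith
      _ = _ := by rw [Real.sqrt_mul ha.le]
  rw [entTerm_eq ha hc]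
  have k1 := key ha hc
  have k2 := key hc ha
  rw [add_comm c a, mul_comm c a] at k2
  unfold bhatTerm
  linarith

theorem entTerm_le_log_two {a c : ℝ} (ha : 0 ≤ a) (hc : 0 ≤ c) :
    entTerm a c ≤ (a + c) * Real.log 2 := by
  have hl : 0 < Real.log 2 := Real.log_pos (by norm_num)
  rcases ha.eq_or_lt with rfl | ha
  · rw [entTerm_zero_left]; positivity
  rcases hc.eq_or_lt with rfl | hc
  · rw [entTerm_zero_right]; positivity
  have key : ∀ {a c : ℝ}, 0 < a → 0 < c → a * Real.log ((a + c) / a) ≤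
      a * Real.log 2 + ((a + c) / 2 - a) := by
    intro a c ha hc
    have h1 := Real.log_le_sub_one_of_pos (x := (a + c) / a / 2) (by positivity)
    rw [Real.log_div (by positivity) (by norm_num)] at h1
    have h2 := mul_le_mul_of_nonneg_left h1 ha.le
    have h3 : a * ((a + c) / a / 2 - 1) = (a + c) / 2 - a := by field_simp
    linarith
  rw [entTerm_eq ha hc]
  have k1 := key ha hc
  have k2 := key hc ha
  rw [add_comm c a] at k2
  linarith

/-- By log t ≤ t - 1 the deficit from (a + c) log 2 is at most (a - c)² / (a + c). With s = a + c
and b = 2 √(a c) this is (s - b)(s + b) / s ≤ 2 (s - b). -/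
theorem le_entTerm {a c : ℝ} (ha : 0 ≤ a) (hc : 0 ≤ c) :
    (a + c) * Real.log 2 - 2 * (a + c - bhatTerm a c) ≤ entTerm a c := by
  have h2 : Real.log 2 ≤ 1 := by
    have := Real.log_le_sub_one_of_pos (show (0 : ℝ) < 2 by norm_num); linarith
  have hl : 0 < Real.log 2 := Real.log_pos (by norm_num)
  rcases ha.eq_or_lt with rfl | ha
  · rw [entTerm_zero_left]; simp [bhatTerm]; nlinarith
  rcases hc.eq_or_lt with rfl | hc
  · rw [entTerm_zero_right]; simp [bhatTerm]; nlinarith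
  have key : ∀ {a c : ℝ}, 0 < a → 0 < c →
      a * Real.log 2 - a * (2 * a / (a + c) - 1) ≤ a * Real.log ((a + c) / a) := by
    intro a c ha hc
    have h1 := Real.log_le_sub_one_of_pos (x := 2 / ((a + c) / a)) (by positivity)
    rw [Real.log_div (by norm_num) (by positivity)] at h1
    have h2 := mul_le_mul_of_nonneg_left h1 ha.le
    have h3 : 2 / ((a + c) / a) = 2 * a / (a + c) := by field_simp
    rw [h3] at h2
    linarith
  rw [entTerm_eq ha hc]
  have k1 := key ha hc
  have k2 := key hc ha
  rw [add_comm c a] at k2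
  have hs : 0 < a + c := by positivity
  set q := √(a * c) with hq
  have hq2 : q ^ 2 = a * c := Real.sq_sqrt (by positivity)
  have e : a * (2 * a / (a + c) - 1) + c * (2 * c / (a + c) - 1) ≤ 2 * (a + c - bhatTerm a c) := by
    have : a * (2 * a / (a + c) - 1) + c * (2 * c / (a + c) - 1) =
        ((a + c) ^ 2 - 4 * q ^ 2) / (a + c) := by
      rw [hq2]; field_simp; ring
    rw [this, div_le_iff₀ hs, bhatTerm]
    nlinarith [sq_nonneg (a + c - 2 * q)]
  linarith

/-- The log-sum inequality: `entTerm` is concave and homogeneous of degree one, hence superadditive.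
This is what lets conditioning reduce entropy. -/
theorem entTerm_add_le {a c a' c' : ℝ} (ha : 0 ≤ a) (hc : 0 ≤ c) (ha' : 0 ≤ a') (hc' : 0 ≤ c') :
    entTerm a c + entTerm a' c' ≤ entTerm (a + a') (c + c') := by
  have key : ∀ {a a' s s' : ℝ}, 0 ≤ a → 0 ≤ a' → a ≤ s → a' ≤ s' →
      a * Real.log s - a * Real.log a + (a' * Real.log s' - a' * Real.log a') ≤
      (a + a') * Real.log (s + s') - (a + a') * Real.log (a + a') := by
    intro a a' s s' ha ha' hs hs'
    -- The inequality log r ≤ r - 1 at r = t B / (b U). Summed over the two terms, the remainders t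
    -- B / U - b cancel.
    have one : ∀ {b t B U : ℝ}, 0 ≤ b → b ≤ t → b ≤ B → t ≤ U →
        b * Real.log t - b * Real.log b ≤ b * Real.log U - b * Real.log B + (t * B / U - b) := by
      intro b t B U hb hbt hbB htU
      rcases hb.eq_or_lt with rfl | hb
      · have : 0 ≤ t * B / U := div_nonneg (mul_nonneg hbt hbB) (hbt.trans htU)
        simpa
      have ht := hb.trans_le hbt
      have hB := hb.trans_le hbB
      have hU := ht.trans_le htU
      have h1 := Real.log_le_sub_one_of_pos (x := t * B / (b * U)) (by positivity)
      rw [Real.log_div (by positivity) (by positivity), Real.log_mul ht.ne' hB.ne',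
        Real.log_mul hb.ne' hU.ne'] at h1
      have h2 := mul_le_mul_of_nonneg_left h1 hb.le
      have h3 : b * (t * B / (b * U) - 1) = t * B / U - b := by field_simp
      linarith
    have o1 := one (B := a + a') (U := s + s') ha hs (by linarith) (by linarith)
    have o2 := one (B := a + a') (U := s + s') ha' hs' (by linarith) (by linarith)
    rcases (add_nonneg (ha.trans hs) (ha'.trans hs')).eq_or_lt with h0 | h0
    · have e1 : a = 0 := by linarith
      have e2 : a' = 0 := by linarith
      simp [e1, e2]
    have : s * (a + a') / (s + s') + s' * (a + a') / (s + s') = a + a' := by field_simp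
    linarith
  have k1 := key ha ha' (le_add_of_nonneg_right hc) (le_add_of_nonneg_right hc')
  have k2 := key hc hc' (le_add_of_nonneg_left ha) (le_add_of_nonneg_left ha')
  have e : a + a' + (c + c') = a + c + (a' + c') := by ring
  simp only [entTerm, Real.negMulLog, e]
  linarith

theorem entTerm_sum_le {ι : Type*} (t : Finset ι) {a c : ι → ℝ} (ha : ∀ i, 0 ≤ a i)
    (hc : ∀ i, 0 ≤ c i) :
    ∑ i ∈ t, entTerm (a i) (c i) ≤ entTerm (∑ i ∈ t, a i) (∑ i ∈ t, c i) := by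
  classical
  induction t using Finset.induction_on with
  | empty => simp [entTerm_zero]
  | insert i t hi ih =>
    rw [Finset.sum_insert hi, Finset.sum_insert hi, Finset.sum_insert hi]
    have := entTerm_add_le (ha i) (hc i) (Finset.sum_nonneg fun j (_ : j ∈ t) => ha j)
      (Finset.sum_nonneg fun j (_ : j ∈ t) => hc j)
    linarith

/-- A binary source with side information. -/
structure BinSource where
  B : Type*
  [fin : Fintype B]
  p : ZMod 2 → B → ℝ
  nonneg : ∀ x b, 0 ≤ p x b
  mass : ∑ b, (p 0 b + p 1 b) = 1

attribute [instance] BinSource.fin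

namespace BinSource

/-- The sum of `φ (p 0 b) (p 1 b)` over the side information. -/
def param (φ : ℝ → ℝ → ℝ) (P : BinSource) : ℝ := ∑ b, φ (P.p 0 b) (P.p 1 b)

theorem one_add_one_zmod : (1 : ZMod 2) + 1 = 0 := by decide

theorem sum_mul_sum_prod {A C : Type*} [Fintype A] [Fintype C] (f : A → ℝ) (g : C → ℝ) :
    ∑ x : A × C, f x.1 * g x.2 = (∑ a, f a) * ∑ c, g c := by
  rw [Fintype.sum_mul_sum, Fintype.sum_prod_type]

theorem sum_zmod_two (f : ZMod 2 → ℝ) : ∑ x, f x = f 0 + f 1 := Fin.sum_univ_two f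

/-- The sum `X₁ + X₂` of two independent copies, given both pieces of side information. -/
def minus (P : BinSource) : BinSource where
  B := P.B × P.B
  p u b := P.p u b.1 * P.p 0 b.2 + P.p (u + 1) b.1 * P.p 1 b.2
  nonneg u b := add_nonneg (mul_nonneg (P.nonneg _ _) (P.nonneg _ _))
    (mul_nonneg (P.nonneg _ _) (P.nonneg _ _))
  mass := by
    have := sum_mul_sum_prod (fun b => P.p 0 b + P.p 1 b) (fun b => P.p 0 b + P.p 1 b)
    rw [P.mass, one_mul] at this
    rw [← this]
    refine Finset.sum_congr rfl fun b _ => ?_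
    rw [zero_add, one_add_one_zmod]
    ring

/-- The second of two independent copies, given `X₁ + X₂` and both pieces of side information. -/
def plus (P : BinSource) : BinSource where
  B := ZMod 2 × P.B × P.B
  p x b := P.p (b.1 + x) b.2.1 * P.p x b.2.2
  nonneg x b := mul_nonneg (P.nonneg _ _) (P.nonneg _ _)
  mass := by
    have := sum_mul_sum_prod (fun b => P.p 0 b + P.p 1 b) (fun b => P.p 0 b + P.p 1 b)
    rw [P.mass, one_mul] at this
    rw [← this, Fintype.sum_prod_type, sum_zmod_two, ← Finset.sum_add_distrib]
    refine Finset.sum_congr rfl fun b _ => ?_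
    simp only [zero_add, add_zero, one_add_one_zmod]
    ring

theorem param_minus (φ : ℝ → ℝ → ℝ) (P : BinSource) :
    P.minus.param φ = ∑ b : P.B × P.B, φ (P.p 0 b.1 * P.p 0 b.2 + P.p 1 b.1 * P.p 1 b.2)
      (P.p 1 b.1 * P.p 0 b.2 + P.p 0 b.1 * P.p 1 b.2) := by
  unfold param
  simp only [minus]
  simp only [zero_add, one_add_one_zmod]
  rfl

theorem param_plus (φ : ℝ → ℝ → ℝ) (P : BinSource) :
    P.plus.param φ = ∑ b : P.B × P.B, (φ (P.p 0 b.1 * P.p 0 b.2) (P.p 1 b.1 * P.p 1 b.2) +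
      φ (P.p 1 b.1 * P.p 0 b.2) (P.p 0 b.1 * P.p 1 b.2)) := by
  change ∑ b : ZMod 2 × P.B × P.B, φ (P.p (b.1 + 0) b.2.1 * P.p 0 b.2.2)
    (P.p (b.1 + 1) b.2.1 * P.p 1 b.2.2) = _
  rw [Fintype.sum_prod_type, sum_zmod_two, ← Finset.sum_add_distrib]
  simp only [zero_add, add_zero, one_add_one_zmod]

/-- Total variation parameter. -/
def tv (P : BinSource) : ℝ := P.param tvTerm

/-- Bhattacharyya parameter. -/
noncomputable def bhat (P : BinSource) : ℝ := P.param bhatTerm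

/-- Conditional entropy in nats. -/
noncomputable def ent (P : BinSource) : ℝ := P.param entTerm

theorem tv_nonneg (P : BinSource) : 0 ≤ P.tv := Finset.sum_nonneg fun _ _ => abs_nonneg _

theorem tv_le_one (P : BinSource) : P.tv ≤ 1 := by
  rw [← P.mass]
  refine Finset.sum_le_sum fun b _ => ?_
  have := P.nonneg 0 b
  have := P.nonneg 1 b
  exact abs_le.2 ⟨by linarith, by linarith⟩

/-- The signed difference p(0) - p(1) is multiplicative under sums of independent bits, so this
transformation is an equality. -/
theorem tv_minus (P : BinSource) : P.minus.tv = P.tv ^ 2 := by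
  rw [tv, param_minus, pow_two, tv, param, ← sum_mul_sum_prod]
  refine Finset.sum_congr rfl fun b _ => ?_
  rw [tvTerm, tvTerm, tvTerm, ← abs_mul]
  congr 1
  ring

/-- |u| + |v| = max(|u + v|, |u - v|), and both u + v = (a + c)(a' - c') and u - v = (a - c)(a' +
c') factor. The right side dominates both products because |a - c| ≤ a + c and |a' - c'| ≤ a' + c'.
-/
theorem abs_sub_add_abs_sub_le {a c a' c' : ℝ} (ha : 0 ≤ a) (hc : 0 ≤ c) (ha' : 0 ≤ a')
    (hc' : 0 ≤ c') :
    |a * a' - c * c'| + |c * a' - a * c'| ≤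
      |a - c| * (a' + c') + (a + c) * |a' - c'| - |a - c| * |a' - c'| := by
  have hd : |a - c| ≤ a + c := abs_le.2 ⟨by linarith, by linarith⟩
  have hd' : |a' - c'| ≤ a' + c' := abs_le.2 ⟨by linarith, by linarith⟩
  have e1 : a * a' - c * c' + (c * a' - a * c') = (a + c) * (a' - c') := by ring
  have e2 : a * a' - c * c' - (c * a' - a * c') = (a - c) * (a' + c') := by ring
  have m : |a * a' - c * c'| + |c * a' - a * c'| ≤
      max ((a + c) * |a' - c'|) (|a - c| * (a' + c')) := by
    have h1 : (a + c) * |a' - c'| = |a * a' - c * c' + (c * a' - a * c')| := by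
      rw [e1, abs_mul, abs_of_nonneg (add_nonneg ha hc)]
    have h2 : |a - c| * (a' + c') = |a * a' - c * c' - (c * a' - a * c')| := by
      rw [e2, abs_mul, abs_of_nonneg (add_nonneg ha' hc')]
    rw [h1, h2]
    rcases abs_cases (a * a' - c * c') with ⟨h, -⟩ | ⟨h, -⟩ <;>
      rcases abs_cases (c * a' - a * c') with ⟨h', -⟩ | ⟨h', -⟩ <;> rw [h, h']
    · exact le_max_of_le_left (le_abs_self _)
    · exact le_max_of_le_right (le_of_eq_of_le (by ring) (le_abs_self _))
    · exact le_max_of_le_right (le_of_eq_of_le (by ring) (neg_le_abs _))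
    · exact le_max_of_le_left (le_of_eq_of_le (by ring) (neg_le_abs _))
  refine m.trans (max_le ?_ ?_)
  · nlinarith [abs_nonneg (a - c), abs_nonneg (a' - c')]
  · nlinarith [abs_nonneg (a - c), abs_nonneg (a' - c')]

theorem tv_plus_le (P : BinSource) : P.plus.tv ≤ 2 * P.tv - P.tv ^ 2 := by
  have h : 2 * P.tv - P.tv ^ 2 = ∑ b : P.B × P.B,
      (tvTerm (P.p 0 b.1) (P.p 1 b.1) * (P.p 0 b.2 + P.p 1 b.2) +
        (P.p 0 b.1 + P.p 1 b.1) * tvTerm (P.p 0 b.2) (P.p 1 b.2) -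
        tvTerm (P.p 0 b.1) (P.p 1 b.1) * tvTerm (P.p 0 b.2) (P.p 1 b.2)) := by
    rw [Finset.sum_sub_distrib, Finset.sum_add_distrib,
      sum_mul_sum_prod (fun b => tvTerm (P.p 0 b) (P.p 1 b)) (fun b => P.p 0 b + P.p 1 b),
      sum_mul_sum_prod (fun b => P.p 0 b + P.p 1 b) (fun b => tvTerm (P.p 0 b) (P.p 1 b)),
      sum_mul_sum_prod (fun b => tvTerm (P.p 0 b) (P.p 1 b))
        (fun b => tvTerm (P.p 0 b) (P.p 1 b)), P.mass]
    simp only [tv, param]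
    ring
  rw [h, tv, param_plus]
  exact Finset.sum_le_sum fun b _ => abs_sub_add_abs_sub_le (P.nonneg _ _) (P.nonneg _ _)
    (P.nonneg _ _) (P.nonneg _ _)

/-- The chain rule for the invertible map (X₁, X₂) ↦ (X₁ + X₂, X₂): entropy is a martingale on the
tree of sources. -/
theorem ent_minus_add_ent_plus (P : BinSource) : P.minus.ent + P.plus.ent = 2 * P.ent := by
  have h : 2 * P.ent = ∑ b : P.B × P.B,
      (entTerm (P.p 0 b.1) (P.p 1 b.1) * (P.p 0 b.2 + P.p 1 b.2) +
        (P.p 0 b.1 + P.p 1 b.1) * entTerm (P.p 0 b.2) (P.p 1 b.2)) := by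
    rw [Finset.sum_add_distrib,
      sum_mul_sum_prod (fun b => entTerm (P.p 0 b) (P.p 1 b)) (fun b => P.p 0 b + P.p 1 b),
      sum_mul_sum_prod (fun b => P.p 0 b + P.p 1 b) (fun b => entTerm (P.p 0 b) (P.p 1 b)),
      P.mass]
    simp only [ent, param]
    ring
  rw [h, ent, ent, param_minus, param_plus, ← Finset.sum_add_distrib]
  refine Finset.sum_congr rfl fun b _ => ?_
  generalize P.p 0 b.1 = a
  generalize P.p 1 b.1 = c
  generalize P.p 0 b.2 = a'
  generalize P.p 1 b.2 = c'
  have e : a * a' + c * c' + (c * a' + a * c') = (a + c) * (a' + c') := by ring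
  simp only [entTerm, e, Real.negMulLog_mul]
  ring

theorem one_le_tv_add_bhat (P : BinSource) : 1 ≤ P.tv + P.bhat := by
  rw [← P.mass, tv, bhat, param, param, ← Finset.sum_add_distrib]
  exact Finset.sum_le_sum fun b _ => le_tvTerm_add_bhatTerm (P.nonneg _ _) (P.nonneg _ _)

theorem bhat_le (P : BinSource) {κ : ℝ} (hκ : 0 < κ) :
    P.bhat ≤ κ + (1 / (2 * κ)) * (1 - P.tv) := by
  have h : κ + (1 / (2 * κ)) * (1 - P.tv) = ∑ b, (κ * (P.p 0 b + P.p 1 b) +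
      (1 / (2 * κ)) * (P.p 0 b + P.p 1 b - tvTerm (P.p 0 b) (P.p 1 b))) := by
    rw [Finset.sum_add_distrib, ← Finset.mul_sum, ← Finset.mul_sum, Finset.sum_sub_distrib, P.mass,
      mul_one, tv, param]
  rw [h]
  exact Finset.sum_le_sum fun b _ => bhatTerm_le (P.nonneg _ _) (P.nonneg _ _) hκ

theorem ent_nonneg (P : BinSource) : 0 ≤ P.ent :=
  Finset.sum_nonneg fun _ _ => entTerm_nonneg (P.nonneg _ _) (P.nonneg _ _)

theorem ent_le_bhat (P : BinSource) : P.ent ≤ 2 * P.bhat := by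
  rw [ent, bhat, param, param, Finset.mul_sum]
  exact Finset.sum_le_sum fun b _ => entTerm_le_bhatTerm (P.nonneg _ _) (P.nonneg _ _)

theorem ent_le_log_two (P : BinSource) : P.ent ≤ Real.log 2 := by
  have h : Real.log 2 = ∑ b, (P.p 0 b + P.p 1 b) * Real.log 2 := by
    rw [← Finset.sum_mul, P.mass, one_mul]
  rw [h]
  exact Finset.sum_le_sum fun b _ => entTerm_le_log_two (P.nonneg _ _) (P.nonneg _ _)

theorem le_ent (P : BinSource) : Real.log 2 - 2 * (1 - P.bhat) ≤ P.ent := by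
  have h : Real.log 2 - 2 * (1 - P.bhat) = ∑ b, ((P.p 0 b + P.p 1 b) * Real.log 2 -
      2 * (P.p 0 b + P.p 1 b - bhatTerm (P.p 0 b) (P.p 1 b))) := by
    rw [Finset.sum_sub_distrib, ← Finset.sum_mul, ← Finset.mul_sum, Finset.sum_sub_distrib, P.mass,
      one_mul, bhat, param]
  rw [h]
  exact Finset.sum_le_sum fun b _ => le_entTerm (P.nonneg _ _) (P.nonneg _ _)

end BinSource

/-! ### Laws of random variables -/

section Law

variable {Ω α γ δ : Type*} [Fintype Ω]

theorem law_nonneg {p : Ω → ℝ} (hp : ∀ w, 0 ≤ p w) (f : Ω → α) (a : α) : 0 ≤ law p f a := by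
  unfold law
  exact Finset.sum_nonneg fun w _ => by split_ifs; exacts [hp w, le_rfl]

theorem law_comp [Fintype α] (p : Ω → ℝ) (f : Ω → α) (g : α → γ) :
    law p (fun w => g (f w)) = law (law p f) g := by
  classical
  funext c
  unfold law
  calc ∑ w, (if g (f w) = c then p w else 0)
      = ∑ w, ∑ a, (if f w = a then if g a = c then p w else 0 else 0) := by
        refine Finset.sum_congr rfl fun w _ => ?_
        rw [Finset.sum_ite_eq]
        simp
    _ = ∑ a, ∑ w, (if f w = a then if g a = c then p w else 0 else 0) := Finset.sum_comm
    _ = _ := by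
        refine Finset.sum_congr rfl fun a _ => ?_
        split_ifs with h
        · rfl
        · simp

theorem sum_law [Fintype α] (p : Ω → ℝ) (f : Ω → α) : ∑ a, law p f a = ∑ w, p w := by
  classical
  unfold law
  rw [Finset.sum_comm]
  simp

theorem law_injective (p : Ω → ℝ) (f : Ω → α) {e : α → γ} (he : Function.Injective e) (a : α) :
    law p (fun w => e (f w)) (e a) = law p f a := by
  classical
  unfold law
  refine Finset.sum_congr rfl fun w _ => ?_
  by_cases h : f w = a
  · simp [h]
  · simp [h, he.ne h]

theorem law_of_forall_ne (p : Ω → ℝ) (f : Ω → α) {a : α} (h : ∀ w, f w ≠ a) : law p f a = 0 := by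
  unfold law
  simp [h]

theorem law_equiv (p : Ω → ℝ) (e : Ω ≃ α) (a : α) : law p e a = p (e.symm a) := by
  classical
  unfold law
  simp [← Equiv.eq_symm_apply]

theorem law_fst_eq_sum [Fintype γ] (p : Ω → ℝ) (f : Ω → α) (g : Ω → γ) (a : α) :
    law p f a = ∑ c, law p (fun w => (f w, g w)) (a, c) := by
  classical
  unfold law
  rw [Finset.sum_comm]
  refine Finset.sum_congr rfl fun w _ => ?_
  by_cases h : f w = a <;> simp [h]

theorem law_snd_eq_sum [Fintype α] (p : Ω → ℝ) (f : Ω → α) (g : Ω → γ) (c : γ) :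
    law p g c = ∑ a, law p (fun w => (f w, g w)) (a, c) := by
  classical
  unfold law
  rw [Finset.sum_comm]
  refine Finset.sum_congr rfl fun w _ => ?_
  by_cases h : g w = c <;> simp [h]

theorem law_pi {ι A : Type*} [Fintype ι] [DecidableEq ι] [Fintype A] (q : A → ℝ) (g : A → α)
    (w : ι → α) : law (fun v : ι → A => ∏ j, q (v j)) (fun v j => g (v j)) w =
      ∏ j, law q g (w j) := by
  classical
  unfold law
  rw [Finset.prod_univ_sum, Fintype.piFinset_univ]
  refine Finset.sum_congr rfl fun v _ => ?_
  split_ifs with h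
  · refine Finset.prod_congr rfl fun j _ => ?_
    rw [if_pos (congrFun h j)]
  · obtain ⟨j, hj⟩ := Function.ne_iff.1 h
    exact (Finset.prod_eq_zero (Finset.mem_univ j) (if_neg hj)).symm

/-- The sum over all values `c` of `g` of `φ (p(f = 0, g = c)) (p(f = 1, g = c))`. -/
noncomputable def condParam [Fintype γ] (φ : ℝ → ℝ → ℝ) (p : Ω → ℝ) (f : Ω → ZMod 2) (g : Ω → γ) : ℝ :=
  ∑ c, φ (law p (fun w => (f w, g w)) (0, c)) (law p (fun w => (f w, g w)) (1, c))

/-- Relabelling the side information is harmless. Symbols outside the range of `e` have mass zero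
and contribute φ 0 0, which is why this value must vanish. -/
theorem condParam_injective [Fintype γ] [Fintype δ] {φ : ℝ → ℝ → ℝ} (hφ : φ 0 0 = 0) (p : Ω → ℝ)
    (f : Ω → ZMod 2) (g : Ω → γ) {e : γ → δ} (he : Function.Injective e) :
    condParam φ p f (fun w => e (g w)) = condParam φ p f g := by
  unfold condParam
  symm
  have key : ∀ x c, law p (fun w => (f w, e (g w))) (x, e c) = law p (fun w => (f w, g w)) (x, c) :=
    fun x c => law_injective p (fun w => (f w, g w)) (e := Prod.map id e)
      (Function.injective_id.prodMap he) (x, c)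
  refine Fintype.sum_of_injective e he _ _ (fun d hd => ?_) fun c => by rw [key, key]
  rw [law_of_forall_ne, law_of_forall_ne, hφ] <;>
  · intro w h
    exact hd ⟨g w, (Prod.mk.inj h).2⟩

theorem condParam_comp [Fintype α] [Fintype γ] (φ : ℝ → ℝ → ℝ) (p : Ω → ℝ) (t : Ω → α)
    (f : α → ZMod 2) (g : α → γ) :
    condParam φ p (fun w => f (t w)) (fun w => g (t w)) = condParam φ (law p t) f g := by
  unfold condParam
  have := law_comp p t (fun a => (f a, g a))
  simp only [this]

/-- Coarser side information merges symbols, and `entTerm` is superadditive. -/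
theorem condParam_ent_le_comp [Fintype γ] [Fintype δ] {p : Ω → ℝ} (hp : ∀ w, 0 ≤ p w)
    (f : Ω → ZMod 2) (g : Ω → γ) (e : γ → δ) :
    condParam entTerm p f g ≤ condParam entTerm p f (fun w => e (g w)) := by
  classical
  unfold condParam
  have key : ∀ x d, law p (fun w => (f w, e (g w))) (x, d) =
      ∑ c with e c = d, law p (fun w => (f w, g w)) (x, c) := by
    intro x d
    rw [show (fun w => (f w, e (g w))) = fun w => Prod.map id e (f w, g w) from rfl,
      law_comp p (fun w => (f w, g w)) (Prod.map id e), law, Fintype.sum_prod_type,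
      Finset.sum_comm, Finset.sum_filter]
    refine Finset.sum_congr rfl fun c _ => ?_
    by_cases h : e c = d <;> simp [h]
  simp only [key]
  rw [← Finset.sum_fiberwise (s := Finset.univ) (g := e)]
  exact Finset.sum_le_sum fun d _ => entTerm_sum_le _ (fun c => law_nonneg hp _ _)
    (fun c => law_nonneg hp _ _)

theorem bhattacharyya_eq_condParam [Fintype γ] {p : Ω → ℝ} (hp : ∀ w, 0 ≤ p w) (f : Ω → ZMod 2)
    (g : Ω → γ) : bhattacharyya p f g = condParam bhatTerm p f g := by
  unfold bhattacharyya condParam bhatTerm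
  rw [Finset.mul_sum]
  refine Finset.sum_congr rfl fun c _ => ?_
  congr 1
  have h0 := law_nonneg hp (fun w => (f w, g w)) (0, c)
  have h1 := law_nonneg hp (fun w => (f w, g w)) (1, c)
  have hs := law_snd_eq_sum p f g c
  rw [BinSource.sum_zmod_two] at hs
  rcases (law_nonneg hp g c).eq_or_lt with h | h
  · have : law p (fun w => (f w, g w)) (0, c) = 0 := by linarith
    rw [← h, this]; simp
  · rw [div_mul_div_comm, Real.sqrt_div (by positivity), Real.sqrt_mul_self h.le]
    field_simp

end Law

/-! ### The polar transform -/

/-- The index `i + 2 ^ n * a` of the pair `(a, i)`. -/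
def splitEquiv (n : ℕ) : Fin 2 × Fin (2 ^ n) ≃ Fin (2 ^ (n + 1)) :=
  finProdFinEquiv.trans (finCongr (pow_succ' 2 n).symm)

theorem splitEquiv_val (n : ℕ) (a : Fin 2) (i : Fin (2 ^ n)) :
    (splitEquiv n (a, i)).val = i + 2 ^ n * a := rfl

/-- Multiplication by the Kronecker power. -/
def kroneckerTransform (n : ℕ) (x : Fin (2 ^ n) → ZMod 2) : Fin (2 ^ n) → ZMod 2 :=
  Matrix.vecMul x (kroneckerPow n)

theorem kroneckerTransform_zero (x : Fin (2 ^ 0) → ZMod 2) : kroneckerTransform 0 x = x :=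
  Matrix.vecMul_one x

theorem kroneckerPow_succ_apply (n : ℕ) (a b : Fin 2) (i j : Fin (2 ^ n)) :
    kroneckerPow (n + 1) (splitEquiv n (a, i)) (splitEquiv n (b, j)) =
      (!![1, 0; 1, 1] : Matrix (Fin 2) (Fin 2) (ZMod 2)) a b * kroneckerPow n i j := by
  change Matrix.reindex (splitEquiv n) (splitEquiv n) _ _ _ = _
  rw [Matrix.reindex_apply, Matrix.submatrix_apply, Equiv.symm_apply_apply, Equiv.symm_apply_apply]
  rfl

theorem kroneckerTransform_succ (n : ℕ) (x : Fin (2 ^ (n + 1)) → ZMod 2) (b : Fin 2)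
    (j : Fin (2 ^ n)) : kroneckerTransform (n + 1) x (splitEquiv n (b, j)) =
      ∑ i, (∑ a, x (splitEquiv n (a, i)) *
        (!![1, 0; 1, 1] : Matrix (Fin 2) (Fin 2) (ZMod 2)) a b) * kroneckerPow n i j := by
  change ∑ k, x k * kroneckerPow (n + 1) k _ = _
  rw [← Equiv.sum_comp (splitEquiv n), Fintype.sum_prod_type, Finset.sum_comm]
  simp only [kroneckerPow_succ_apply, Finset.sum_mul, mul_assoc]

theorem kroneckerTransform_succ_zero (n : ℕ) (x : Fin (2 ^ (n + 1)) → ZMod 2) (j : Fin (2 ^ n)) :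
    kroneckerTransform (n + 1) x (splitEquiv n (0, j)) =
      kroneckerTransform n (fun i => x (splitEquiv n (0, i)) + x (splitEquiv n (1, i))) j := by
  rw [kroneckerTransform_succ]
  simp [kroneckerTransform, Matrix.vecMul, dotProduct]

theorem kroneckerTransform_succ_one (n : ℕ) (x : Fin (2 ^ (n + 1)) → ZMod 2) (j : Fin (2 ^ n)) :
    kroneckerTransform (n + 1) x (splitEquiv n (1, j)) =
      kroneckerTransform n (fun i => x (splitEquiv n (1, i))) j := by
  rw [kroneckerTransform_succ]
  simp [kroneckerTransform, Matrix.vecMul, dotProduct]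

theorem kroneckerTransform_injective (n : ℕ) : Function.Injective (kroneckerTransform n) := by
  induction n with
  | zero => intro x y h; rwa [kroneckerTransform_zero, kroneckerTransform_zero] at h
  | succ n ih =>
    intro x y h
    have h1 := @ih (fun i => x (splitEquiv n (1, i))) (fun i => y (splitEquiv n (1, i)))
      (funext fun j => by
        rw [← kroneckerTransform_succ_one, h, kroneckerTransform_succ_one])
    have h0 := @ih (fun i => x (splitEquiv n (0, i)) + x (splitEquiv n (1, i)))
      (fun i => y (splitEquiv n (0, i)) + y (splitEquiv n (1, i))) (funext fun j => by
        rw [← kroneckerTransform_succ_zero, h, kroneckerTransform_succ_zero])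
    funext k
    obtain ⟨⟨a, i⟩, rfl⟩ := (splitEquiv n).surjective k
    have e1 : x (splitEquiv n (1, i)) = y (splitEquiv n (1, i)) := congrFun h1 i
    have e0 : x (splitEquiv n (0, i)) + x (splitEquiv n (1, i)) =
      y (splitEquiv n (0, i)) + y (splitEquiv n (1, i)) := congrFun h0 i
    fin_cases a
    · rw [e1] at e0
      exact add_right_cancel e0
    · exact e1

/-- The bit reversal of an index. -/
def bitRev (n : ℕ) : Equiv.Perm (Fin (2 ^ n)) :=
  Function.Involutive.toPerm (fun i => (BitVec.ofFin i).reverse.toFin) fun i => by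
    simp

/-- Bit reversal only permutes the input positions. The block is i.i.d., so it leaves no trace in
the laws (`law_blockLaw`). -/
theorem polarU_eq {Y Z : Type*} (n : ℕ) (v : Fin (2 ^ n) → ZMod 2 × Y × Z) :
    polarU n v = kroneckerTransform n (fun k => (v (bitRev n k)).1) := by
  unfold polarU polarMatrix kroneckerTransform
  rw [← Matrix.vecMul_vecMul]
  congr 1
  funext k
  change ∑ i, (v i).1 * bitReversal n i k = _
  have : ∀ i, bitReversal n i k = if i = bitRev n k then 1 else 0 := by
    intro i
    unfold bitReversal
    refine if_congr ?_ rfl rfl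
    change k = bitRev n i ↔ _
    rw [← Equiv.symm_apply_eq, eq_comm]
    rfl
  simp [this]

/-- The entries of `u` with index less than `j`; the other ones are replaced by `0`. -/
def below {N : ℕ} (j : Fin N) (u : Fin N → ZMod 2) : Fin N → ZMod 2 :=
  fun i => if i < j then u i else 0

namespace BinSource

/-- The law of `2 ^ n` independent copies. -/
def blockProb (P : BinSource) (n : ℕ) (v : Fin (2 ^ n) → ZMod 2 × P.B) : ℝ :=
  ∏ j, P.p (v j).1 (v j).2

/-- The parameter of the entry `j` of the transformed vector given the preceding entries and the
side information. -/
noncomputable def polarParam (φ : ℝ → ℝ → ℝ) (n : ℕ) (P : BinSource) (j : Fin (2 ^ n)) : ℝ :=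
  condParam φ (P.blockProb n) (fun v => kroneckerTransform n (fun k => (v k).1) j)
    (fun v => (below j (kroneckerTransform n fun k => (v k).1), fun k => (v k).2))

/-- Two copies of the source, mapped to the source `P.minus`. -/
def minusMap (P : BinSource) (v : (ZMod 2 × P.B) × (ZMod 2 × P.B)) : ZMod 2 × P.minus.B :=
  (v.1.1 + v.2.1, (v.1.2, v.2.2))

/-- Two copies of the source, mapped to the source `P.plus`. -/
def plusMap (P : BinSource) (v : (ZMod 2 × P.B) × (ZMod 2 × P.B)) : ZMod 2 × P.plus.B :=
  (v.2.1, (v.1.1 + v.2.1, v.1.2, v.2.2))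

theorem law_minusMap (P : BinSource) (w : ZMod 2 × P.minus.B) :
    law (fun v : (ZMod 2 × P.B) × (ZMod 2 × P.B) => P.p v.1.1 v.1.2 * P.p v.2.1 v.2.2)
      P.minusMap w = P.minus.p w.1 w.2 := by
  classical
  obtain ⟨u, b, b'⟩ := w
  simp only [law, minusMap, minus, Fintype.sum_prod_type, Prod.mk.injEq]
  rw [sum_zmod_two]
  simp only [sum_zmod_two]
  have h : ∀ u : ZMod 2, u = 0 ∨ u = 1 := by decide
  rcases h u with rfl | rfl <;> simp [ite_and, one_add_one_zmod, add_comm]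

theorem law_plusMap (P : BinSource) (w : ZMod 2 × P.plus.B) :
    law (fun v : (ZMod 2 × P.B) × (ZMod 2 × P.B) => P.p v.1.1 v.1.2 * P.p v.2.1 v.2.2)
      P.plusMap w = P.plus.p w.1 w.2 := by
  classical
  obtain ⟨x, u, b, b'⟩ := w
  simp only [law, plusMap, plus, Fintype.sum_prod_type, Prod.mk.injEq]
  rw [sum_zmod_two]
  simp only [sum_zmod_two]
  have h : ∀ u : ZMod 2, u = 0 ∨ u = 1 := by decide
  rcases h u with rfl | rfl <;> rcases h x with rfl | rfl <;>
    simp [ite_and, one_add_one_zmod]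

/-- The pairs of entries of a vector that are combined first. -/
def pairing (A : Type*) (n : ℕ) : (Fin (2 ^ (n + 1)) → A) ≃ (Fin (2 ^ n) → A × A) where
  toFun v i := (v (splitEquiv n (0, i)), v (splitEquiv n (1, i)))
  invFun w k := if ((splitEquiv n).symm k).1 = 0 then (w ((splitEquiv n).symm k).2).1 else
    (w ((splitEquiv n).symm k).2).2
  left_inv v := by
    funext k
    obtain ⟨⟨a, i⟩, rfl⟩ := (splitEquiv n).surjective k
    fin_cases a <;> simp
  right_inv w := by
    funext i
    simp

theorem law_pairing (P : BinSource) (n : ℕ) : law (P.blockProb (n + 1)) (pairing _ n) =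
    fun w => ∏ i, (P.p (w i).1.1 (w i).1.2 * P.p (w i).2.1 (w i).2.2) := by
  funext w
  rw [law_equiv]
  obtain ⟨v, rfl⟩ := (pairing _ n).surjective w
  rw [Equiv.symm_apply_apply, blockProb, ← Equiv.prod_comp (splitEquiv n), Fintype.prod_prod_type,
    Fin.prod_univ_two, ← Finset.prod_mul_distrib]
  rfl

theorem law_minus_pairing (P : BinSource) (n : ℕ) :
    law (P.blockProb (n + 1)) (fun v i => P.minusMap (pairing _ n v i)) = P.minus.blockProb n := by
  rw [law_comp _ (pairing _ n) (fun w i => P.minusMap (w i)), law_pairing]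
  funext w
  rw [law_pi (fun v : (ZMod 2 × P.B) × (ZMod 2 × P.B) => P.p v.1.1 v.1.2 * P.p v.2.1 v.2.2)]
  simp only [law_minusMap]
  rfl

theorem law_plus_pairing (P : BinSource) (n : ℕ) :
    law (P.blockProb (n + 1)) (fun v i => P.plusMap (pairing _ n v i)) = P.plus.blockProb n := by
  rw [law_comp _ (pairing _ n) (fun w i => P.plusMap (w i)), law_pairing]
  funext w
  rw [law_pi (fun v : (ZMod 2 × P.B) × (ZMod 2 × P.B) => P.p v.1.1 v.1.2 * P.p v.2.1 v.2.2)]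
  simp only [law_plusMap]
  rfl

theorem splitEquiv_lt_iff (n : ℕ) (a b : Fin 2) (i j : Fin (2 ^ n)) :
    splitEquiv n (a, i) < splitEquiv n (b, j) ↔ a < b ∨ a = b ∧ i < j := by
  rw [Fin.lt_def, splitEquiv_val, splitEquiv_val]
  have := i.isLt
  have := j.isLt
  fin_cases a <;> fin_cases b <;> simp <;> omega

theorem polarParam_zero {φ : ℝ → ℝ → ℝ} (hφ : φ 0 0 = 0) (P : BinSource) (j : Fin (2 ^ 0)) :
    P.polarParam φ 0 j = P.param φ := by
  classical
  have hj : ∀ i : Fin (2 ^ 0), i = j := fun i => Subsingleton.elim (α := Fin 1) i j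
  unfold polarParam
  let e : (Fin (2 ^ 0) → ZMod 2 × P.B) ≃ ZMod 2 × P.B := Equiv.funUnique (Fin 1) _
  have he : ∀ v k, e v = v k := fun v k => congrArg v (Subsingleton.elim (α := Fin 1) _ _)
  have h1 := condParam_comp φ (P.blockProb 0) e Prod.fst Prod.snd
  have h2 := condParam_injective hφ (P.blockProb 0) (fun v => (e v).1) (fun v => (e v).2)
    (e := fun b : P.B => ((fun _ => 0 : Fin (2 ^ 0) → ZMod 2), (fun _ => b : Fin (2 ^ 0) → P.B)))
    (fun b b' h => congrFun (Prod.mk.inj h).2 j)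
  have h3 : law (P.blockProb 0) e = fun x => P.p x.1 x.2 := by
    funext x
    rw [law_equiv]
    obtain ⟨v, rfl⟩ := e.surjective x
    rw [Equiv.symm_apply_apply, blockProb, Fintype.prod_eq_single j fun i hi => (hi (hj i)).elim,
      he v j]
  trans condParam φ (P.blockProb 0) (fun v => (e v).1) (fun v =>
    ((fun _ => 0 : Fin (2 ^ 0) → ZMod 2), (fun _ => (e v).2 : Fin (2 ^ 0) → P.B)))
  · congr 1
    · funext v
      rw [kroneckerTransform_zero, he v j]
    · funext v
      congr 1
      · funext i
        rw [below, if_neg (by rw [hj i]; exact lt_irrefl j)]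
      · funext k
        rw [he v k]
  · rw [h2, h1, h3]
    unfold condParam param
    have : ∀ x b, law (fun x : ZMod 2 × P.B => P.p x.1 x.2) (fun w => (w.1, w.2)) (x, b) =
        P.p x b := fun x b => law_equiv _ (Equiv.refl _) (x, b)
    simp only [this]

/-- In the first half the transformed vector depends only on the sums of paired inputs, and all
preceding entries lie in the same half. So the entry is one of a block of copies of `P.minus`. -/
theorem polarParam_succ_zero {φ : ℝ → ℝ → ℝ} (hφ : φ 0 0 = 0) (P : BinSource) (n : ℕ)
    (j : Fin (2 ^ n)) :
    P.polarParam φ (n + 1) (splitEquiv n (0, j)) = P.minus.polarParam φ n j := by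
  conv_rhs => unfold polarParam
  rw [← law_minus_pairing, ← condParam_comp φ (P.blockProb (n + 1))]
  let e : (Fin (2 ^ n) → ZMod 2) × (Fin (2 ^ n) → P.minus.B) →
      (Fin (2 ^ (n + 1)) → ZMod 2) × (Fin (2 ^ (n + 1)) → P.B) := fun c =>
    ((pairing _ n).symm fun i => (c.1 i, 0), (pairing _ n).symm c.2)
  have he : Function.Injective e := by
    intro c c' h
    have h1 := (pairing _ n).symm.injective (Prod.mk.inj h).1
    have h2 := (pairing _ n).symm.injective (Prod.mk.inj h).2
    exact Prod.ext (funext fun i => (Prod.mk.inj (congrFun h1 i)).1) h2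
  rw [← condParam_injective hφ _ _ _ he]
  unfold polarParam
  congr 1
  · funext v
    exact kroneckerTransform_succ_zero _ _ _
  · funext v
    refine Prod.ext ?_ ?_
    · refine ((Equiv.eq_symm_apply _).2 ?_)
      funext i
      refine Prod.ext ?_ ?_
      · change below _ _ (splitEquiv n (0, i)) = below _ _ _
        simp only [below, splitEquiv_lt_iff, kroneckerTransform_succ_zero]
        simp only [lt_irrefl, true_and, false_or]
        rfl
      · change below _ _ (splitEquiv n (1, i)) = 0
        simp [below, splitEquiv_lt_iff]
    · exact ((Equiv.eq_symm_apply _).2 rfl)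

/-- In the second half the whole first half is already known. By injectivity of the transform this
amounts to knowing all sums of paired inputs, which is exactly the additional side information of
`P.plus`. -/
theorem polarParam_succ_one {φ : ℝ → ℝ → ℝ} (hφ : φ 0 0 = 0) (P : BinSource) (n : ℕ)
    (j : Fin (2 ^ n)) :
    P.polarParam φ (n + 1) (splitEquiv n (1, j)) = P.plus.polarParam φ n j := by
  conv_rhs => unfold polarParam
  rw [← law_plus_pairing, ← condParam_comp φ (P.blockProb (n + 1))]
  let e : (Fin (2 ^ n) → ZMod 2) × (Fin (2 ^ n) → P.plus.B) →
      (Fin (2 ^ (n + 1)) → ZMod 2) × (Fin (2 ^ (n + 1)) → P.B) := fun c =>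
    ((pairing _ n).symm fun i => (kroneckerTransform n (fun k => (c.2 k).1) i, c.1 i),
      (pairing _ n).symm fun k => (c.2 k).2)
  have he : Function.Injective e := by
    intro c c' h
    have h1 := (pairing _ n).symm.injective (Prod.mk.inj h).1
    have h2 := (pairing _ n).symm.injective (Prod.mk.inj h).2
    have h3 := kroneckerTransform_injective n (funext fun i => (Prod.mk.inj (congrFun h1 i)).1)
    exact Prod.ext (funext fun i => (Prod.mk.inj (congrFun h1 i)).2)
      (funext fun i => Prod.ext (congrFun h3 i) (congrFun h2 i))
  rw [← condParam_injective hφ _ _ _ he]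
  unfold polarParam
  congr 1
  · funext v
    exact kroneckerTransform_succ_one _ _ _
  · funext v
    refine Prod.ext ?_ ?_
    · refine ((Equiv.eq_symm_apply _).2 ?_)
      funext i
      refine Prod.ext ?_ ?_
      · change below _ _ (splitEquiv n (0, i)) = kroneckerTransform n _ i
        simp only [below, splitEquiv_lt_iff, kroneckerTransform_succ_zero]
        rw [if_pos (Or.inl (by decide))]
        rfl
      · change below _ _ (splitEquiv n (1, i)) = below _ _ _
        simp only [below, splitEquiv_lt_iff, kroneckerTransform_succ_one]
        simp only [lt_irrefl, true_and, false_or]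
        rfl
    · exact ((Equiv.eq_symm_apply _).2 rfl)

/-- The source that belongs to an entry of the transformed vector. -/
def leaf : (n : ℕ) → BinSource → Fin (2 ^ n) → BinSource
  | 0, P, _ => P
  | n + 1, P, k => leaf n (if ((splitEquiv n).symm k).1 = 0 then P.minus else P.plus)
      ((splitEquiv n).symm k).2

theorem polarParam_eq_leaf {φ : ℝ → ℝ → ℝ} (hφ : φ 0 0 = 0) (n : ℕ) (P : BinSource)
    (j : Fin (2 ^ n)) : P.polarParam φ n j = (leaf n P j).param φ := by
  induction n generalizing P with
  | zero => exact polarParam_zero hφ P j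
  | succ n ih =>
    obtain ⟨⟨a, i⟩, rfl⟩ := (splitEquiv n).surjective j
    fin_cases a
    · simp only [leaf, Equiv.symm_apply_apply, Fin.zero_eta, if_true]
      rw [polarParam_succ_zero hφ, ih]
    · simp only [leaf, Equiv.symm_apply_apply, Fin.mk_one, one_ne_zero, if_false]
      rw [polarParam_succ_one hφ, ih]

theorem sum_leaf (g : BinSource → ℝ) (n : ℕ) (P : BinSource) :
    ∑ j, g (leaf n P j) = 2 ^ n * treeAvg minus plus n g P := by
  induction n generalizing P with
  | zero =>
    change ∑ j : Fin 1, g P = _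
    simp [treeAvg]
  | succ n ih =>
    rw [← Equiv.sum_comp (splitEquiv n), Fintype.sum_prod_type, Fin.sum_univ_two]
    simp only [leaf, Equiv.symm_apply_apply, one_ne_zero, if_true, if_false, ih, treeAvg]
    ring

end BinSource

/-! ### The sources of a block of channel uses -/

section Block

variable {Y Z B γ : Type*} [Fintype Y] [Fintype Z] [Fintype B] [Fintype γ]

theorem channel_nonneg {X : Type*} (W : Channel X Y Z) (x : X) (o : Y × Z) : 0 ≤ W x o :=
  (W x).2.1 o

theorem channel_sum {X : Type*} (W : Channel X Y Z) (x : X) : ∑ o, W x o = 1 := (W x).2.2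

/-- The channel input together with the function `h` of the channel output. -/
noncomputable def channelSource (Q : stdSimplex ℝ (ZMod 2)) (W : Channel (ZMod 2) Y Z) (h : Y × Z → B) :
    BinSource where
  B := B
  p x b := Q x * law (W x) h b
  nonneg x b := mul_nonneg (Q.2.1 x) (law_nonneg (channel_nonneg W x) h b)
  mass := by
    rw [Finset.sum_add_distrib, ← Finset.mul_sum, ← Finset.mul_sum, sum_law, sum_law, channel_sum,
      channel_sum, mul_one, mul_one, ← BinSource.sum_zmod_two]
    exact Q.2.2

theorem blockLaw_nonneg {X : Type*} [Fintype X] (Q : stdSimplex ℝ X) (W : Channel X Y Z) (N : ℕ)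
    (v : Fin N → X × Y × Z) : 0 ≤ blockLaw Q W N v :=
  Finset.prod_nonneg fun _ _ => mul_nonneg (Q.2.1 _) (channel_nonneg W _ _)

theorem law_blockLaw (Q : stdSimplex ℝ (ZMod 2)) (W : Channel (ZMod 2) Y Z) (h : Y × Z → B)
    (n : ℕ) : law (blockLaw Q W (2 ^ n))
      (fun v k => (((v (bitRev n k)).1, h (v (bitRev n k)).2) : ZMod 2 × (channelSource Q W h).B)) =
        (channelSource Q W h).blockProb n := by
  classical
  let e : (Fin (2 ^ n) → ZMod 2 × Y × Z) ≃ (Fin (2 ^ n) → ZMod 2 × Y × Z) :=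
    Equiv.arrowCongr (bitRev n) (Equiv.refl _)
  have he : ∀ v k, e v k = v (bitRev n k) := fun v k => rfl
  have h1 : law (blockLaw Q W (2 ^ n)) e = blockLaw Q W (2 ^ n) := by
    funext w
    rw [law_equiv]
    obtain ⟨v, rfl⟩ := e.surjective w
    rw [Equiv.symm_apply_apply]
    unfold blockLaw
    simp only [he]
    rw [Equiv.prod_comp (bitRev n) (fun k => Q (v k).1 * W (v k).1 (v k).2)]
  have h2 := law_comp (blockLaw Q W (2 ^ n)) e (fun w k => ((w k).1, h (w k).2))
  simp only [he, h1] at h2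
  refine h2.trans ?_
  funext w
  unfold blockLaw
  rw [law_pi (fun a : ZMod 2 × Y × Z => Q a.1 * W a.1 a.2) (fun a => (a.1, h a.2))]
  unfold BinSource.blockProb
  refine Finset.prod_congr rfl fun k _ => ?_
  obtain ⟨x, b⟩ := w k
  simp only [law, channelSource]
  rw [Fintype.sum_prod_type, Fintype.sum_eq_single x fun y hy => by simp [hy], Finset.mul_sum]
  refine Finset.sum_congr rfl fun o _ => ?_
  by_cases ho : h o = b <;> simp [ho]

/-- The map `e` presents the side information `g` losslessly as one symbol per channel use. This
covers no side information, Y^N and Z^N uniformly. -/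
theorem condParam_polarU {φ : ℝ → ℝ → ℝ} (hφ : φ 0 0 = 0) (Q : stdSimplex ℝ (ZMod 2))
    (W : Channel (ZMod 2) Y Z) (n : ℕ) (j : Fin (2 ^ n)) (h : Y × Z → B)
    (g : (Fin (2 ^ n) → ZMod 2 × Y × Z) → γ) {e : γ → Fin (2 ^ n) → B}
    (he : Function.Injective e) (hg : ∀ v, e (g v) = fun k => h (v k).2) :
    condParam φ (blockLaw Q W (2 ^ n)) (fun v => polarU n v j)
      (fun v => ((fun i : Fin j.val => polarU n v (i.castLE j.isLt.le)), g v)) =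
      (BinSource.leaf n (channelSource Q W h) j).param φ := by
  rw [← BinSource.polarParam_eq_leaf hφ]
  unfold BinSource.polarParam
  rw [← law_blockLaw, ← condParam_comp φ (blockLaw Q W (2 ^ n))]
  let e' : (Fin j.val → ZMod 2) × γ → (Fin (2 ^ n) → ZMod 2) × (Fin (2 ^ n) → (channelSource Q W h).B) := fun c =>
    (fun i => if hi : i < j then c.1 ⟨i.val, hi⟩ else 0, fun k => e c.2 (bitRev n k))
  have he' : Function.Injective e' := by
    intro c c' hc
    refine Prod.ext (funext fun i => ?_) (he (funext fun k => ?_))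
    · have := congrFun (Prod.mk.inj hc).1 (i.castLE j.isLt.le)
      have hi : i.castLE j.isLt.le < j := i.isLt
      simpa [hi] using this
    · have := congrFun (Prod.mk.inj hc).2 ((bitRev n).symm k)
      simpa using this
  rw [← condParam_injective hφ _ _ _ he']
  congr 1
  · funext v
    rw [polarU_eq]
  · funext v
    refine Prod.ext (funext fun i => ?_) (funext fun k => ?_)
    · simp only [e', below, polarU_eq]
      rfl
    · simp only [e', hg]
      rfl

theorem polarZ_eq_leaf (Q : stdSimplex ℝ (ZMod 2))
    (W : Channel (ZMod 2) Y Z) (n : ℕ) (j : Fin (2 ^ n)) (h : Y × Z → B)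
    (g : (Fin (2 ^ n) → ZMod 2 × Y × Z) → γ) {e : γ → Fin (2 ^ n) → B}
    (he : Function.Injective e) (hg : ∀ v, e (g v) = fun k => h (v k).2) :
    polarZ Q W n g j = (BinSource.leaf n (channelSource Q W h) j).bhat := by
  unfold polarZ
  rw [bhattacharyya_eq_condParam (blockLaw_nonneg Q W _)]
  exact condParam_polarU bhatTerm_zero Q W n j h g he hg

theorem ent_leaf_le_ent_leaf_unit (Q : stdSimplex ℝ (ZMod 2)) (W : Channel (ZMod 2) Y Z) (n : ℕ)
    (j : Fin (2 ^ n)) (h : Y × Z → B) :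
    (BinSource.leaf n (channelSource Q W h) j).ent ≤
      (BinSource.leaf n (channelSource Q W fun _ => ()) j).ent := by
  unfold BinSource.ent
  rw [← condParam_polarU entTerm_zero Q W n j h (fun v k => h (v k).2) (e := id)
      Function.injective_id fun _ => rfl,
    ← condParam_polarU entTerm_zero Q W n j (fun _ => ()) (fun _ => ()) (e := fun _ _ => ())
      (fun _ _ _ => rfl) fun _ => rfl]
  exact condParam_ent_le_comp (blockLaw_nonneg Q W _) (fun v => polarU n v j)
    (fun v => ((fun i : Fin j.val => polarU n v (i.castLE j.isLt.le)), fun k => h (v k).2))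
    (fun c => (c.1, ()))

end Block

/-! ### The size of the index sets -/

theorem polarDelta_eq (β : ℝ) (n : ℕ) : polarDelta β n = (2 : ℝ) ^ (-(2 : ℝ) ^ (β * n)) := by
  unfold polarDelta
  congr 2
  push_cast
  rw [← Real.rpow_natCast, ← Real.rpow_mul (by norm_num), mul_comm]

theorem polarDelta_pos (β : ℝ) (n : ℕ) : 0 < polarDelta β n := by
  unfold polarDelta; positivity

theorem tendsto_polarDelta {β : ℝ} (hβ : 0 < β) : Tendsto (polarDelta β) atTop (𝓝 0) := by
  have h1 : Tendsto (fun n : ℕ => ((2 ^ n : ℕ) : ℝ) ^ β) atTop atTop :=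
    (tendsto_rpow_atTop hβ).comp (tendsto_natCast_atTop_atTop.comp
      (tendsto_pow_atTop_atTop_of_one_lt (by norm_num)))
  exact (tendsto_rpow_atBot_of_base_gt_one 2 (by norm_num)).comp (tendsto_neg_atTop_atBot.comp h1)

namespace BinSource

open scoped Classical in
/-- Polarization: the fraction of the indices with total variation at most `2 ^ (-N ^ β)` is
asymptotically at least the entropy of the source. -/
theorem eventually_ent_le {β ε : ℝ} (hβ0 : 0 < β) (hβ1 : β < 1 / 2) (hε : 0 < ε) (P : BinSource) :
    ∀ᶠ n in atTop, P.ent - ε ≤ Real.log 2 *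
      treeAvg minus plus n (fun P => if P.tv ≤ polarDelta β n then 1 else 0) P := by
  have hl0 : 0 < Real.log 2 := Real.log_pos (by norm_num)
  have hl1 : Real.log 2 ≤ 1 := by
    have := Real.log_le_sub_one_of_pos (show (0 : ℝ) < 2 by norm_num); linarith
  -- The exponent halfway between β and 1/2 leaves room for the first m generations, which do not
  -- contribute to the doubly exponential decay.
  obtain ⟨z, hz, hfast⟩ := exists_treeAvg_fast tv_nonneg tv_le_one tv_minus tv_plus_le
    (β := (β + 1 / 2) / 2) (ε := ε / 2) (by linarith) (by linarith) (by linarith)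
  set κ := ε / 8 with hκ
  have hκ0 : 0 < κ := by positivity
  set C := 1 / (4 * κ ^ 3 * z ^ 2) with hC
  have hC0 : 0 < C := by positivity
  obtain ⟨m, hm⟩ := ((tendsto_treeAvg_polarization tv_nonneg tv_le_one tv_minus tv_plus_le
    P).eventually_lt_const (show 0 < κ / C by positivity)).exists
  -- A source with T > z has entropy at most 2κ + (1 - T) / κ. Completing a square bounds this by 3κ
  -- plus a multiple of (1 - T)², and (1 - T)² ≤ (T (1 - T))² / z² is small on average by
  -- polarization. Averaging, with entropy a martingale, shows that T ≤ z holds for a fraction of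
  -- nearly H of the descendants.
  have point : ∀ P : BinSource, P.ent ≤ Real.log 2 * (if P.tv ≤ z then 1 else 0) +
      (3 * κ + C * (P.tv * (1 - P.tv)) ^ 2) := by
    intro P
    split_ifs with h
    · have := P.ent_le_log_two
      have : 0 ≤ C * (P.tv * (1 - P.tv)) ^ 2 := by positivity
      linarith
    · push Not at h
      have h1 := P.ent_le_bhat
      have h2 := P.bhat_le hκ0
      have hd : 0 ≤ 1 - P.tv := by linarith [P.tv_le_one]
      have h3 : (1 - P.tv) / κ ≤ κ + (1 - P.tv) ^ 2 / (4 * κ ^ 3) := by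
        have : κ + (1 - P.tv) ^ 2 / (4 * κ ^ 3) - (1 - P.tv) / κ =
            (2 * κ ^ 2 - (1 - P.tv)) ^ 2 / (4 * κ ^ 3) := by field_simp; ring
        have : 0 ≤ (2 * κ ^ 2 - (1 - P.tv)) ^ 2 / (4 * κ ^ 3) := by positivity
        linarith
      have h4 : (1 - P.tv) ^ 2 / (4 * κ ^ 3) ≤ C * (P.tv * (1 - P.tv)) ^ 2 := by
        have e : (1 - P.tv) ^ 2 / (4 * κ ^ 3) = C * (z ^ 2 * (1 - P.tv) ^ 2) := by
          rw [hC]; field_simp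
        rw [e, mul_pow]
        gcongr
      have h5 : 2 * (1 / (2 * κ) * (1 - P.tv)) = (1 - P.tv) / κ := by field_simp
      linarith
  have main : P.ent ≤ Real.log 2 * treeAvg minus plus m (fun P => if P.tv ≤ z then 1 else 0) P +
      4 * κ := by
    have h := treeAvg_mono minus plus point m P
    rw [treeAvg_eq_of_martingale minus plus ent_minus_add_ent_plus, treeAvg_add,
      treeAvg_const_mul, treeAvg_add, treeAvg_const, treeAvg_const_mul] at h
    rw [lt_div_iff₀ hC0] at hm
    linarith
  obtain ⟨n₁, hn₁⟩ := eventually_atTop.1 hfast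
  -- For n = m + k ≥ n₂ one has β (m + k) ≤ ((β + 1/2) / 2) k, so the threshold reached after k
  -- further generations lies below δ_N.
  obtain ⟨n₂, hn₂⟩ := exists_nat_ge ((β + 1 / 2) / 2 * m / ((1 / 2 - β) / 2))
  filter_upwards [eventually_ge_atTop (m + n₁ + n₂)] with n hn
  obtain ⟨k, rfl⟩ : ∃ k, n = m + k := ⟨n - m, by omega⟩
  have hδ : (2 : ℝ) ^ (-(2 : ℝ) ^ ((β + 1 / 2) / 2 * k)) ≤ polarDelta β (m + k) := by
    rw [polarDelta_eq]
    apply Real.rpow_le_rpow_of_exponent_le (by norm_num)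
    rw [neg_le_neg_iff]
    apply Real.rpow_le_rpow_of_exponent_le (by norm_num)
    rw [div_le_iff₀ (by linarith)] at hn₂
    have : (n₂ : ℝ) + m ≤ m + k := by exact_mod_cast (by omega : n₂ + m ≤ m + k)
    have h3 : (n₂ : ℝ) * ((1 / 2 - β) / 2) ≤ (m + k) * ((1 / 2 - β) / 2) := by
      apply mul_le_mul_of_nonneg_right _ (by linarith)
      have : (0 : ℝ) ≤ m := Nat.cast_nonneg m
      linarith
    push_cast
    linarith
  have h1 : (1 - ε / 2) * treeAvg minus plus m (fun P => if P.tv ≤ z then 1 else 0) P ≤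
      treeAvg minus plus (m + k) (fun P => if P.tv ≤ polarDelta β (m + k) then 1 else 0) P := by
    rw [treeAvg_comp, ← treeAvg_const_mul]
    refine treeAvg_mono _ _ (fun P => ?_) m P
    split_ifs with h
    · rw [mul_one]
      refine (hn₁ k (by omega) P h).trans (treeAvg_mono _ _ (fun P => ?_) k P)
      split_ifs with h h'
      · norm_num
      · exact absurd (h.trans hδ) h'
      · norm_num
      · norm_num
    · rw [mul_zero]
      exact treeAvg_nonneg _ _ (fun P => by split_ifs <;> norm_num) k P
  have h2 : treeAvg minus plus m (fun P : BinSource => if P.tv ≤ z then (1 : ℝ) else 0) P ≤ 1 := by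
    have := treeAvg_mono minus plus (f := fun P : BinSource => if P.tv ≤ z then (1 : ℝ) else 0)
      (g := fun _ => 1) (fun s => by split_ifs <;> norm_num) m P
    rwa [treeAvg_const] at this
  have h3 := mul_le_mul_of_nonneg_left h1 hl0.le
  have h4 : Real.log 2 * (ε / 2 * treeAvg minus plus m
      (fun P : BinSource => if P.tv ≤ z then (1 : ℝ) else 0) P) ≤ ε / 2 := by
    have h0 : 0 ≤ treeAvg minus plus m (fun P : BinSource => if P.tv ≤ z then (1 : ℝ) else 0) P :=
      treeAvg_nonneg _ _ (fun P => by split_ifs <;> norm_num) m P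
    have : Real.log 2 * (ε / 2 * treeAvg minus plus m
      (fun P : BinSource => if P.tv ≤ z then (1 : ℝ) else 0) P) ≤ 1 * (ε / 2 * 1) := by gcongr
    linarith
  linarith

theorem sum_ent_leaf (n : ℕ) (P : BinSource) : ∑ j, (leaf n P j).ent = 2 ^ n * P.ent := by
  rw [sum_leaf ent, treeAvg_eq_of_martingale minus plus ent_minus_add_ent_plus]

end BinSource

section IndexCount

variable {Y Z : Type*} [Fintype Y] [Fintype Z] {β : ℝ} (Q : stdSimplex ℝ (ZMod 2))
  (W : Channel (ZMod 2) Y Z)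

theorem mem_setHX {n : ℕ} {j : Fin (2 ^ n)} : j ∈ setHX β Q W n ↔
    1 - polarDelta β n ≤ (BinSource.leaf n (channelSource Q W fun _ => ()) j).bhat := by
  unfold setHX highSet
  rw [Finset.mem_filter, polarZ_eq_leaf Q W n j (fun _ => ()) (fun _ => ()) (e := fun _ _ => ())
    (fun _ _ _ => rfl) fun _ => rfl]
  simp

theorem mem_setLXY {n : ℕ} {j : Fin (2 ^ n)} : j ∈ setLXY β Q W n ↔
    (BinSource.leaf n (channelSource Q W Prod.fst) j).bhat ≤ polarDelta β n := by
  unfold setLXY lowSet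
  rw [Finset.mem_filter, polarZ_eq_leaf Q W n j Prod.fst (fun v j => (v j).2.1) (e := id)
    Function.injective_id fun _ => rfl]
  simp

theorem mem_setHXZ {n : ℕ} {j : Fin (2 ^ n)} : j ∈ setHXZ β Q W n ↔
    1 - polarDelta β n ≤ (BinSource.leaf n (channelSource Q W Prod.snd) j).bhat := by
  unfold setHXZ highSet
  rw [Finset.mem_filter, polarZ_eq_leaf Q W n j Prod.snd (fun v j => (v j).2.2) (e := id)
    Function.injective_id fun _ => rfl]
  simp

/-- With C = (H_X \ L_{X|Y}) ∩ H_{X|Z}, the sets I and C are disjoint inside H_{X|Z}, while B and C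
cover H_X \ L_{X|Y}. The unknown |C| cancels. -/
theorem card_setI_sub_card_setB_le (n : ℕ) : ((setI β Q W n).card : ℝ) - (setB β Q W n).card ≤
    (setHXZ β Q W n).card - (setHX β Q W n \ setLXY β Q W n).card := by
  set C := (setHX β Q W n \ setLXY β Q W n) ∩ setHXZ β Q W n with hC
  have h1 : (setI β Q W n).card + C.card ≤ (setHXZ β Q W n).card := by
    rw [← Finset.card_union_of_disjoint]
    · apply Finset.card_le_card
      intro j
      simp only [setI, hC, Finset.mem_union, Finset.mem_inter]
      tauto
    · rw [Finset.disjoint_left]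
      intro j
      simp only [setI, hC, Finset.mem_inter, Finset.mem_sdiff]
      tauto
  have h2 : (setHX β Q W n \ setLXY β Q W n).card ≤ (setB β Q W n).card + C.card := by
    refine le_trans (Finset.card_le_card ?_) (Finset.card_union_le _ _)
    intro j
    simp only [setB, hC, Finset.mem_union, Finset.mem_inter, Finset.mem_sdiff, Finset.mem_compl]
    tauto
  have h1' : ((setI β Q W n).card : ℝ) + C.card ≤ (setHXZ β Q W n).card := by exact_mod_cast h1
  have h2' : ((setHX β Q W n \ setLXY β Q W n).card : ℝ) ≤ (setB β Q W n).card + C.card := by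
    exact_mod_cast h2
  linarith

/-- Each index of H_{X|Z} carries entropy at least log 2 - 2δ, and the total entropy is conserved.
-/
theorem card_setHXZ_le (n : ℕ) : ((setHXZ β Q W n).card : ℝ) * (Real.log 2 - 2 * polarDelta β n) ≤
    2 ^ n * (channelSource Q W Prod.snd).ent := by
  rw [← BinSource.sum_ent_leaf, ← nsmul_eq_mul]
  refine (Finset.card_nsmul_le_sum _ _ _ fun j hj => ?_).trans
    (Finset.sum_le_univ_sum_of_nonneg fun j => BinSource.ent_nonneg _)
  rw [mem_setHXZ] at hj
  linarith [BinSource.le_ent (BinSource.leaf n (channelSource Q W Prod.snd) j)]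

/-- Fast polarization makes |H_X| log 2 almost as large as the total entropy N H(X). Since the
indices of H_X have nearly full entropy, they exhaust this total, and little is left for the others.
-/
theorem eventually_sum_compl_setHX_le (hβ0 : 0 < β) (hβ1 : β < 1 / 2) {ε : ℝ} (hε : 0 < ε) :
    ∀ᶠ n in atTop, ∑ j ∈ (setHX β Q W n)ᶜ,
      (BinSource.leaf n (channelSource Q W fun _ => ()) j).ent ≤
        2 ^ n * (ε + 2 * polarDelta β n) := by
  classical
  filter_upwards [BinSource.eventually_ent_le hβ0 hβ1 hε (channelSource Q W fun _ => ())] with n hn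
  have hδ := polarDelta_pos β n
  have h1 : ((setHX β Q W n).card : ℝ) * (Real.log 2 - 2 * polarDelta β n) ≤
      ∑ j ∈ setHX β Q W n, (BinSource.leaf n (channelSource Q W fun _ => ()) j).ent := by
    rw [← nsmul_eq_mul]
    refine Finset.card_nsmul_le_sum _ _ _ fun j hj => ?_
    rw [mem_setHX] at hj
    linarith [BinSource.le_ent (BinSource.leaf n (channelSource Q W fun _ => ()) j)]
  have h2 : 2 ^ n * treeAvg BinSource.minus BinSource.plus n
      (fun P => if P.tv ≤ polarDelta β n then 1 else 0) (channelSource Q W fun _ => ()) ≤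
      (setHX β Q W n).card := by
    rw [← BinSource.sum_leaf, ← Finset.sum_filter, Finset.sum_const, nsmul_eq_mul, mul_one]
    norm_cast
    refine Finset.card_le_card fun j hj => ?_
    rw [mem_setHX]
    have := (Finset.mem_filter.1 hj).2
    linarith [BinSource.one_le_tv_add_bhat (BinSource.leaf n (channelSource Q W fun _ => ()) j)]
  have h3 : ((setHX β Q W n).card : ℝ) ≤ 2 ^ n := by
    have := Finset.card_le_univ (setHX β Q W n)
    rw [Fintype.card_fin] at this
    exact_mod_cast this
  have h4 := BinSource.sum_ent_leaf n (channelSource Q W fun _ => ())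
  rw [← Finset.sum_add_sum_compl (setHX β Q W n)] at h4
  have hl0 : 0 < Real.log 2 := Real.log_pos (by norm_num)
  have h5 := mul_le_mul_of_nonneg_left h2 hl0.le
  have h6 := mul_le_mul_of_nonneg_left hn (show (0 : ℝ) ≤ 2 ^ n by positivity)
  have h7 := mul_le_mul_of_nonneg_right h3 hδ.le
  linarith

/-- The entropy N H(X|Y) is bounded index by index: by log 2 on H_X \ L_{X|Y}, by 2δ on H_X ∩
L_{X|Y}, and outside H_X by the entropy without side information. -/
theorem le_card_setHX_sdiff (n : ℕ) : 2 ^ n * (channelSource Q W Prod.fst).ent ≤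
    Real.log 2 * (setHX β Q W n \ setLXY β Q W n).card + 2 ^ n * (2 * polarDelta β n) +
      ∑ j ∈ (setHX β Q W n)ᶜ, (BinSource.leaf n (channelSource Q W fun _ => ()) j).ent := by
  classical
  have hδ := polarDelta_pos β n
  have hl0 : 0 < Real.log 2 := Real.log_pos (by norm_num)
  have e1 : Real.log 2 * ((setHX β Q W n \ setLXY β Q W n).card : ℝ) =
      ∑ j, if j ∈ setHX β Q W n \ setLXY β Q W n then Real.log 2 else 0 := by
    rw [Finset.sum_ite_mem, Finset.univ_inter, Finset.sum_const, nsmul_eq_mul, mul_comm]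
  have e2 : (2 : ℝ) ^ n * (2 * polarDelta β n) = ∑ j : Fin (2 ^ n), 2 * polarDelta β n := by
    rw [Finset.sum_const, Finset.card_univ, Fintype.card_fin, nsmul_eq_mul]
    push_cast
    rfl
  have e3 : ∑ j ∈ (setHX β Q W n)ᶜ, (BinSource.leaf n (channelSource Q W fun _ => ()) j).ent =
      ∑ j, if j ∈ (setHX β Q W n)ᶜ then
        (BinSource.leaf n (channelSource Q W fun _ => ()) j).ent else 0 := by
    rw [Finset.sum_ite_mem, Finset.univ_inter]
  rw [← BinSource.sum_ent_leaf, e1, e2, e3, ← Finset.sum_add_distrib, ← Finset.sum_add_distrib]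
  refine Finset.sum_le_sum fun j _ => ?_
  have a1 := ent_leaf_le_ent_leaf_unit Q W n j Prod.fst
  have a2 := BinSource.ent_le_bhat (BinSource.leaf n (channelSource Q W Prod.fst) j)
  have a3 := BinSource.ent_le_log_two (BinSource.leaf n (channelSource Q W Prod.fst) j)
  have a4 := BinSource.ent_nonneg (BinSource.leaf n (channelSource Q W fun _ => ()) j)
  by_cases hX : j ∈ setHX β Q W n
  · by_cases hL : j ∈ setLXY β Q W n
    · have := (mem_setLXY Q W).1 hL
      simp only [Finset.mem_sdiff, Finset.mem_compl, hX, hL]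
      norm_num
      linarith
    · simp only [Finset.mem_sdiff, Finset.mem_compl, hX, hL]
      norm_num
      linarith
  · simp only [Finset.mem_sdiff, Finset.mem_compl, hX]
    norm_num
    linarith

/-- Asymptotically, `|I| - |B|` is at most `N (H(X|Z) - H(X|Y))`. -/
theorem eventually_card_setI_sub_le (hβ0 : 0 < β) (hβ1 : β < 1 / 2) {ε : ℝ} (hε : 0 < ε) :
    ∀ᶠ n in atTop, ((setI β Q W n).card : ℝ) - (setB β Q W n).card ≤ 2 ^ n *
      (((channelSource Q W Prod.snd).ent - (channelSource Q W Prod.fst).ent) / Real.log 2 + ε) := by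
  have hl0 : 0 < Real.log 2 := Real.log_pos (by norm_num)
  -- The three estimates lose 2δ each, together at most half of ε log 2 when δ < ε log 2 / 12; the
  -- other half goes to the entropy outside H_X.
  have hε' : 0 < ε * Real.log 2 / 2 := by positivity
  filter_upwards [eventually_sum_compl_setHX_le Q W hβ0 hβ1 hε',
    (tendsto_polarDelta hβ0).eventually_lt_const (show 0 < ε * Real.log 2 / 12 by positivity)]
    with n h1 h2
  have hδ := polarDelta_pos β n
  refine (card_setI_sub_card_setB_le Q W n).trans ?_
  have h3 := card_setHXZ_le (β := β) Q W n
  have h4 := le_card_setHX_sdiff (β := β) Q W n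
  have h5 : ((setHXZ β Q W n).card : ℝ) ≤ 2 ^ n := by
    have := Finset.card_le_univ (setHXZ β Q W n)
    rw [Fintype.card_fin] at this
    exact_mod_cast this
  have h6 := mul_le_mul_of_nonneg_right h5 hδ.le
  have h7 := mul_le_mul_of_nonneg_left h2.le (show (0 : ℝ) ≤ 2 ^ n by positivity)
  have e : (2 : ℝ) ^ n * (((channelSource Q W Prod.snd).ent - (channelSource Q W Prod.fst).ent) /
      Real.log 2 + ε) = (2 ^ n * (channelSource Q W Prod.snd).ent -
      2 ^ n * (channelSource Q W Prod.fst).ent + 2 ^ n * (ε * Real.log 2)) / Real.log 2 := by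
    field_simp
  rw [e, le_div_iff₀ hl0]
  linarith

end IndexCount

/-! ### Entropy -/

section Entropy

variable {Ω α γ δ : Type*} [Fintype Ω]

theorem log_two_pos : 0 < Real.log 2 := Real.log_pos (by norm_num)

theorem sum_mul_law [Fintype α] (p : Ω → ℝ) (f : Ω → α) (ψ : α → ℝ) :
    ∑ a, ψ a * law p f a = ∑ w, ψ (f w) * p w := by
  classical
  unfold law
  simp only [Finset.mul_sum]
  rw [Finset.sum_comm]
  simp

theorem law_const_mul (c : ℝ) (p : Ω → ℝ) (f : Ω → α) (a : α) :
    law (fun w => c * p w) f a = c * law p f a := by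
  unfold law
  rw [Finset.mul_sum]
  exact Finset.sum_congr rfl fun w _ => by split_ifs <;> simp

theorem entropy_injective [Fintype α] [Fintype γ] (p : Ω → ℝ) (f : Ω → α) {e : α → γ}
    (he : Function.Injective e) : entropy p (fun w => e (f w)) = entropy p f := by
  unfold entropy
  symm
  refine Fintype.sum_of_injective e he _ _ (fun c hc => ?_) fun a => by
    rw [law_injective p f he]
  rw [law_of_forall_ne p _ fun w h => hc ⟨f w, h⟩]
  simp

theorem entropy_comp [Fintype α] [Fintype γ] (p : Ω → ℝ) (f : Ω → α) (g : α → γ) :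
    entropy p (fun w => g (f w)) = entropy (law p f) g := by
  unfold entropy
  rw [law_comp]

/-- Conditioning is expressed by restricted, unnormalized mass functions. The correction term
depends only on `c` and the total mass, so it cancels in differences of entropies. -/
theorem entropy_const_mul [Fintype α] (c : ℝ) (p : Ω → ℝ) (f : Ω → α) :
    entropy (fun w => c * p w) f =
      c * entropy p f + (∑ w, p w) * (Real.negMulLog c / Real.log 2) := by
  unfold entropy
  simp only [law_const_mul, Real.negMulLog_mul]
  rw [← sum_law p f, Finset.sum_mul, Finset.mul_sum, ← Finset.sum_add_distrib]
  exact Finset.sum_congr rfl fun a _ => by ring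

/-- Chain rule: the entropy of a pair `(v, g)` is the sum over the values of `v` of the entropy of
`g` under the restricted mass function. -/
theorem entropy_prod_eq_sum [Fintype α] [Fintype γ] [Fintype δ] (p : Ω → ℝ) (v : Ω → α) (t : Ω → γ)
    (g : γ → δ) : entropy p (fun w => (v w, g (t w))) =
      ∑ a, entropy (fun c => law p (fun w => (v w, t w)) (a, c)) g := by
  classical
  have h := entropy_comp p (fun w => (v w, t w)) (Prod.map id g)
  refine h.trans ?_
  unfold entropy
  rw [Fintype.sum_prod_type]
  refine Finset.sum_congr rfl fun a _ => Finset.sum_congr rfl fun d _ => ?_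
  congr 2
  unfold law
  rw [Fintype.sum_prod_type, Fintype.sum_eq_single a fun b hb => by simp [hb]]
  exact Finset.sum_congr rfl fun c _ => by simp

theorem negMulLog_le_gibbs {u v : ℝ} (hu : 0 ≤ u) (hv : 0 ≤ v) (h : v = 0 → u = 0) :
    Real.negMulLog u ≤ -(u * Real.log v) + (v - u) := by
  rcases hu.eq_or_lt with rfl | hu
  · simpa
  have hv : 0 < v := lt_of_le_of_ne hv fun h0 => hu.ne' (h h0.symm)
  have h1 := Real.log_le_sub_one_of_pos (x := v / u) (by positivity)
  rw [Real.log_div hv.ne' hu.ne'] at h1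
  have h2 := mul_le_mul_of_nonneg_left h1 hu.le
  have h3 : u * (v / u - 1) = v - u := by field_simp
  unfold Real.negMulLog
  linarith

theorem law_pair_le_left [Fintype γ] {p : Ω → ℝ} (hp : ∀ w, 0 ≤ p w) (f : Ω → α) (g : Ω → γ) (a : α)
    (c : γ) : law p (fun w => (f w, g w)) (a, c) ≤ law p f a := by
  rw [law_fst_eq_sum p f g a]
  exact Finset.single_le_sum (f := fun c => law p (fun w => (f w, g w)) (a, c))
    (fun c _ => law_nonneg hp _ _) (Finset.mem_univ c)

theorem law_pair_le_right [Fintype α] {p : Ω → ℝ} (hp : ∀ w, 0 ≤ p w) (f : Ω → α) (g : Ω → γ)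
    (a : α) (c : γ) : law p (fun w => (f w, g w)) (a, c) ≤ law p g c := by
  rw [law_snd_eq_sum p f g c]
  exact Finset.single_le_sum (f := fun a => law p (fun w => (f w, g w)) (a, c))
    (fun a _ => law_nonneg hp _ _) (Finset.mem_univ a)

theorem mutualInfo_nonneg [Fintype α] [Fintype γ] {p : Ω → ℝ} (hp : ∀ w, 0 ≤ p w)
    (h1 : ∑ w, p w = 1) (f : Ω → α) (g : Ω → γ) : 0 ≤ mutualInfo p f g := by
  have key : ∑ x : α × γ, Real.negMulLog (law p (fun w => (f w, g w)) x) ≤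
      ∑ a, Real.negMulLog (law p f a) + ∑ c, Real.negMulLog (law p g c) := by
    have e1 : ∑ a, Real.negMulLog (law p f a) = ∑ a, ∑ c,
        -(law p (fun w => (f w, g w)) (a, c) * Real.log (law p f a)) := by
      refine Finset.sum_congr rfl fun a _ => ?_
      rw [Finset.sum_neg_distrib, ← Finset.sum_mul, ← law_fst_eq_sum, Real.negMulLog, neg_mul]
    have e2 : ∑ c, Real.negMulLog (law p g c) = ∑ a, ∑ c,
        -(law p (fun w => (f w, g w)) (a, c) * Real.log (law p g c)) := by
      rw [Finset.sum_comm]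
      refine Finset.sum_congr rfl fun c _ => ?_
      rw [Finset.sum_neg_distrib, ← Finset.sum_mul, ← law_snd_eq_sum, Real.negMulLog, neg_mul]
    have e3 : ∑ a, ∑ c, (law p f a * law p g c - law p (fun w => (f w, g w)) (a, c)) = 0 := by
      simp only [Finset.sum_sub_distrib, ← law_fst_eq_sum]
      rw [← Fintype.sum_mul_sum, sum_law, sum_law, h1]
      norm_num
    rw [e1, e2, ← Finset.sum_add_distrib, Fintype.sum_prod_type]
    rw [← add_zero (∑ a, (_ + _)), ← e3, ← Finset.sum_add_distrib]
    refine Finset.sum_le_sum fun a _ => ?_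
    rw [← Finset.sum_add_distrib, ← Finset.sum_add_distrib]
    refine Finset.sum_le_sum fun c _ => ?_
    have l0 := law_nonneg hp (fun w => (f w, g w)) (a, c)
    have l1 := law_pair_le_left hp f g a c
    have l2 := law_pair_le_right hp f g a c
    rcases l0.eq_or_lt with h | h
    · rw [← h]
      simpa using mul_nonneg (law_nonneg hp f a) (law_nonneg hp g c)
    · have := negMulLog_le_gibbs l0 (mul_nonneg (law_nonneg hp f a) (law_nonneg hp g c))
        fun h0 => absurd h0 (mul_pos (h.trans_le l1) (h.trans_le l2)).ne'
      rw [Real.log_mul (h.trans_le l1).ne' (h.trans_le l2).ne'] at this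
      linarith
  unfold mutualInfo entropy
  rw [← Finset.sum_div, ← Finset.sum_div, ← Finset.sum_div, ← add_div, ← sub_div]
  exact div_nonneg (by linarith) log_two_pos.le

theorem entropy_le_card [Fintype α] {p : Ω → ℝ} (hp : ∀ w, 0 ≤ p w) (f : Ω → α) :
    entropy p f ≤ Fintype.card α / Real.log 2 := by
  unfold entropy
  rw [← Finset.sum_div, ← nsmul_one, ← Finset.card_univ]
  refine div_le_div_of_nonneg_right (Finset.sum_le_card_nsmul _ _ _ fun a _ => ?_) log_two_pos.le
  have := negMulLog_le_gibbs (law_nonneg hp f a) zero_le_one (by norm_num)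
  rw [Real.log_one] at this
  linarith [law_nonneg hp f a]

theorem entropy_le_entropy_pair [Fintype α] [Fintype γ] {p : Ω → ℝ} (hp : ∀ w, 0 ≤ p w) (f : Ω → α)
    (g : Ω → γ) : entropy p f ≤ entropy p (fun w => (f w, g w)) := by
  unfold entropy
  rw [Fintype.sum_prod_type]
  refine Finset.sum_le_sum fun a _ => ?_
  rw [← Finset.sum_div]
  refine div_le_div_of_nonneg_right ?_ log_two_pos.le
  rw [Real.negMulLog]
  conv_lhs => rw [law_fst_eq_sum p f g a]
  rw [← Finset.sum_neg_distrib, Finset.sum_mul, ← law_fst_eq_sum]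
  refine Finset.sum_le_sum fun c _ => ?_
  have l0 := law_nonneg hp (fun w => (f w, g w)) (a, c)
  have l1 := law_pair_le_left hp f g a c
  rcases l0.eq_or_lt with h | h
  · rw [← h]; simp
  · have := mul_le_mul_of_nonneg_left (Real.log_le_log h l1) l0
    rw [Real.negMulLog]
    linarith

end Entropy

/-! ### The secrecy capacity -/

section Capacity

variable {X Y Z : Type*} [Fintype X] [Fintype Y] [Fintype Z] (W : Channel X Y Z)

/-- The joint mass function of `(U, X)` and the channel output. -/
def auxLaw {k : ℕ} (q : Fin k × X → ℝ) (w : (Fin k × X) × (Y × Z)) : ℝ := q w.1 * W w.1.2 w.2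

theorem sum_auxLaw {k : ℕ} (q : Fin k × X → ℝ) : ∑ w, auxLaw W q w = ∑ x, q x := by
  unfold auxLaw
  rw [Fintype.sum_prod_type]
  simp only [← Finset.mul_sum, channel_sum, mul_one]

omit [Fintype X] in
theorem auxLaw_nonneg {k : ℕ} {q : Fin k × X → ℝ} (hq : ∀ x, 0 ≤ q x)
    (w : (Fin k × X) × (Y × Z)) : 0 ≤ auxLaw W q w :=
  mul_nonneg (hq _) (channel_nonneg W _ _)

theorem bddAbove_secrecyRates : BddAbove (secrecyRates W) := by
  refine ⟨Fintype.card Y / Real.log 2, ?_⟩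
  rintro r ⟨k, q, rfl⟩
  have hp := auxLaw_nonneg W (q := q) q.2.1
  have h1 : ∑ w, auxLaw W q w = 1 := (sum_auxLaw W q).trans q.2.2
  have a1 := mutualInfo_nonneg hp h1 (fun w => w.1.1) (fun w => w.2.2)
  have a2 := entropy_le_card hp (fun w : (Fin k × X) × (Y × Z) => w.2.1)
  have a3 := entropy_le_entropy_pair hp (fun w => w.1.1) (fun w => w.2.1)
  have a4 : mutualInfo (auxLaw W q) (fun w => w.1.1) (fun w => w.2.1) ≤
      Fintype.card Y / Real.log 2 := by
    unfold mutualInfo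
    linarith
  change mutualInfo (auxLaw W q) (fun w => w.1.1) (fun w => w.2.1) -
    mutualInfo (auxLaw W q) (fun w => w.1.1) (fun w => w.2.2) ≤ _
  linarith

/-- A constant auxiliary variable (alphabet of size one) gives the value 0. -/
theorem secrecyCapacity_nonneg [Nonempty X] : 0 ≤ secrecyCapacity W := by
  classical
  refine le_csSup (bddAbove_secrecyRates W) ⟨1, ⟨Pi.single (0, Classical.arbitrary X) 1,
    single_mem_stdSimplex _ _⟩, ?_⟩
  set q : stdSimplex ℝ (Fin 1 × X) := ⟨Pi.single (0, Classical.arbitrary X) 1,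
    single_mem_stdSimplex _ _⟩
  have h1 := entropy_injective (auxLaw W q) (fun w => w.2.1) (e := fun y => ((0 : Fin 1), y))
    fun y y' h => (Prod.mk.inj h).2
  have h2 := entropy_injective (auxLaw W q) (fun w => w.2.2) (e := fun y => ((0 : Fin 1), y))
    fun y y' h => (Prod.mk.inj h).2
  have e1 : (fun w : (Fin 1 × X) × (Y × Z) => (w.1.1, w.2.1)) = fun w => (0, w.2.1) :=
    funext fun w => Prod.ext (Subsingleton.elim _ _) rfl
  have e2 : (fun w : (Fin 1 × X) × (Y × Z) => (w.1.1, w.2.2)) = fun w => (0, w.2.2) :=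
    funext fun w => Prod.ext (Subsingleton.elim _ _) rfl
  change 0 = mutualInfo (auxLaw W q) (fun w => w.1.1) (fun w => w.2.1) -
    mutualInfo (auxLaw W q) (fun w => w.1.1) (fun w => w.2.2)
  unfold mutualInfo
  rw [e1, e2, h1, h2]
  ring

/-- `H(Y) - H(U, Y) - (H(Z) - H(U, Z))`, which equals `I(U; Y) - I(U; Z)`. -/
noncomputable def secrecyGap {k : ℕ} (q : Fin k × X → ℝ) : ℝ :=
  entropy (auxLaw W q) (fun w => w.2.1) - entropy (auxLaw W q) (fun w => (w.1.1, w.2.1)) -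
    (entropy (auxLaw W q) (fun w => w.2.2) - entropy (auxLaw W q) (fun w => (w.1.1, w.2.2)))

theorem secrecyGap_le_of_sum_eq_one {k : ℕ} {q : Fin k × X → ℝ} (hq : ∀ x, 0 ≤ q x)
    (h1 : ∑ x, q x = 1) : secrecyGap W q ≤ secrecyCapacity W := by
  refine le_csSup (bddAbove_secrecyRates W) ⟨k, ⟨q, hq, h1⟩, ?_⟩
  change _ = mutualInfo (auxLaw W q) (fun w => w.1.1) (fun w => w.2.1) -
    mutualInfo (auxLaw W q) (fun w => w.1.1) (fun w => w.2.2)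
  unfold mutualInfo secrecyGap
  ring

theorem secrecyGap_const_mul {k : ℕ} (c : ℝ) (q : Fin k × X → ℝ) :
    secrecyGap W (fun x => c * q x) = c * secrecyGap W q := by
  have : auxLaw W (fun x => c * q x) = fun w => c * auxLaw W q w := by
    funext w
    simp only [auxLaw]
    ring
  unfold secrecyGap
  simp only [this, entropy_const_mul]
  ring

/-- Homogeneity extends the definition of the capacity to mass functions of arbitrary total mass.
This allows conditional information to be bounded by summing over the values of the condition. -/
theorem secrecyGap_le {k : ℕ} {q : Fin k × X → ℝ} (hq : ∀ x, 0 ≤ q x) :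
    secrecyGap W q ≤ (∑ x, q x) * secrecyCapacity W := by
  rcases (Finset.sum_nonneg fun x (_ : x ∈ Finset.univ) => hq x).eq_or_lt with h | h
  · have h0 : q = fun x => 0 * q x := by
      funext x
      rw [zero_mul]
      exact (Finset.sum_eq_zero_iff_of_nonneg fun x _ => hq x).1 h.symm x (Finset.mem_univ x)
    rw [← h, h0, secrecyGap_const_mul]
    simp
  · set m := ∑ x, q x
    have h0 : q = fun x => m * (m⁻¹ * q x) := by
      funext x
      field_simp
    rw [h0, secrecyGap_const_mul]
    refine mul_le_mul_of_nonneg_left (secrecyGap_le_of_sum_eq_one W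
      (fun x => mul_nonneg (inv_nonneg.2 h.le) (hq x)) ?_) h.le
    rw [← Finset.mul_sum, inv_mul_cancel₀ h.ne']

end Capacity

/-! ### The channel input as auxiliary variable -/

section Uncoded

variable {Y Z : Type*} [Fintype Y] [Fintype Z] (Q : stdSimplex ℝ (ZMod 2))
  (W : Channel (ZMod 2) Y Z)

/-- The elements of `Fin 2` as bits. -/
def finTwoEquivZMod : Fin 2 ≃ ZMod 2 := Equiv.refl _

/-- The auxiliary variable `U = X`. -/
noncomputable def diagLaw (x : Fin 2 × ZMod 2) : ℝ :=
  if finTwoEquivZMod x.1 = x.2 then Q x.2 else 0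

theorem diagLaw_nonneg (x : Fin 2 × ZMod 2) : 0 ≤ diagLaw Q x := by
  unfold diagLaw
  split_ifs
  exacts [Q.2.1 _, le_rfl]

theorem sum_diagLaw : ∑ x, diagLaw Q x = 1 := by
  rw [Fintype.sum_prod_type]
  have : ∀ u : Fin 2, ∑ x, diagLaw Q (u, x) = Q (finTwoEquivZMod u) := fun u => by
    simp [diagLaw]
  simp only [this]
  exact Q.2.2

theorem entropy_diagLaw {B : Type*} [Fintype B] (h : Y × Z → B) :
    entropy (auxLaw W (diagLaw Q)) (fun w => (w.1.1, h w.2)) -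
      entropy (auxLaw W (diagLaw Q)) (fun w => h w.2) = (channelSource Q W h).ent / Real.log 2 := by
  classical
  have key : ∀ u b, law (auxLaw W (diagLaw Q)) (fun w => (w.1.1, h w.2)) (u, b) =
      (channelSource Q W h).p (finTwoEquivZMod u) b := by
    intro u b
    simp only [law, auxLaw, channelSource]
    rw [Fintype.sum_prod_type, Fintype.sum_prod_type, Fintype.sum_eq_single u fun v hv => by
      simp [hv], Fintype.sum_eq_single (finTwoEquivZMod u) fun v hv => by
        simp [diagLaw, hv.symm], Finset.mul_sum]
    refine Finset.sum_congr rfl fun o _ => ?_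
    by_cases ho : h o = b <;> simp [ho, diagLaw]
  have key2 : ∀ b, law (auxLaw W (diagLaw Q)) (fun w => h w.2) b =
      (channelSource Q W h).p 0 b + (channelSource Q W h).p 1 b := by
    intro b
    refine (law_snd_eq_sum (auxLaw W (diagLaw Q)) (fun w => w.1.1) (fun w => h w.2) b).trans ?_
    rw [Fin.sum_univ_two, key, key]
    rfl
  unfold entropy
  rw [Fintype.sum_prod_type, Fin.sum_univ_two, ← Finset.sum_add_distrib, ← Finset.sum_sub_distrib,
    BinSource.ent, BinSource.param, Finset.sum_div]
  refine Finset.sum_congr rfl fun b _ => ?_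
  rw [key, key, key2, entTerm, ← add_div, ← sub_div]
  rfl

theorem ent_sub_ent_le_secrecyCapacity :
    ((channelSource Q W Prod.snd).ent - (channelSource Q W Prod.fst).ent) / Real.log 2 ≤
      secrecyCapacity W := by
  have h := secrecyGap_le_of_sum_eq_one W (diagLaw_nonneg Q) (sum_diagLaw Q)
  have h1 := entropy_diagLaw Q W Prod.fst
  have h2 := entropy_diagLaw Q W Prod.snd
  unfold secrecyGap at h
  rw [sub_div]
  linarith

end Uncoded

/-! ### Fano's inequality -/

section Fano

variable {Ω γ : Type*} [Fintype Ω] [Fintype γ]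

open scoped Classical in
/-- Fano's inequality for a uniform message, in terms of the mutual information. -/
theorem le_entropy_sub_of_uniform {K : ℕ} (hK : 1 ≤ K) {p : Ω → ℝ} (hp : ∀ w, 0 ≤ p w)
    (h1 : ∑ w, p w = 1) (f : Ω → Fin K) (g : Ω → γ) (dec : γ → Option (Fin K)) :
    entropy p (fun w => (f w, g w)) - entropy p g ≤
      1 + (∑ w, if dec (g w) ≠ some (f w) then p w else 0) * (Real.log K / Real.log 2) := by
  have hK0 : (0 : ℝ) < K := by exact_mod_cast hK
  have hlK : 0 ≤ Real.log K := Real.log_nonneg (by exact_mod_cast hK)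
  -- Gibbs' inequality is used with this reference conditional law: an equal mixture of the
  -- decoder's decision and the uniform law. Its log-loss is at most log 2, plus log K on an error.
  -- If the decoder declares an error, its total mass is only 1/2, which is why `hr1` is an
  -- inequality.
  set r : Fin K → γ → ℝ := fun m c => (if dec c = some m then 1 / 2 else 0) + 1 / (2 * K) with hr
  have hr0 : ∀ m c, 0 < r m c := by
    intro m c
    simp only [hr]
    split_ifs <;> positivity
  have hr1 : ∀ c, ∑ m, r m c ≤ 1 := by
    intro c
    simp only [hr]
    rw [Finset.sum_add_distrib, Finset.sum_const, Finset.card_univ, Fintype.card_fin, nsmul_eq_mul]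
    have e : (K : ℝ) * (1 / (2 * K)) = 1 / 2 := by field_simp
    have : ∑ m, (if dec c = some m then (1 / 2 : ℝ) else 0) ≤ 1 / 2 := by
      rcases hd : dec c with - | m
      · simp
      · simp
    linarith
  have hlog : ∀ m c, -Real.log (r m c) ≤
      Real.log 2 + (if dec c ≠ some m then Real.log K else 0) := by
    intro m c
    simp only [hr]
    by_cases h : dec c = some m
    · have : Real.log (1 / 2) ≤ Real.log (1 / 2 + 1 / (2 * K)) :=
        Real.log_le_log (by norm_num) (by linarith [show (0 : ℝ) ≤ 1 / (2 * K) by positivity])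
      rw [one_div, Real.log_inv] at this
      simp only [h, ne_eq, not_true_eq_false, if_true, if_false, one_div] at this ⊢
      linarith
    · simp only [h, ne_eq, not_false_eq_true, if_true, if_false, zero_add]
      rw [one_div, Real.log_inv, Real.log_mul (by norm_num) hK0.ne']
      linarith
  set P : Fin K × γ → ℝ := law p (fun w => (f w, g w)) with hP
  have hP0 : ∀ x, 0 ≤ P x := law_nonneg hp _
  have term : ∀ m c, Real.negMulLog (P (m, c)) ≤ -(P (m, c) * Real.log (law p g c)) +
      P (m, c) * (Real.log 2 + (if dec c ≠ some m then Real.log K else 0)) +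
      (law p g c * r m c - P (m, c)) := by
    intro m c
    have l2 := law_pair_le_right hp f g m c
    rcases (hP0 (m, c)).eq_or_lt with h | h
    · rw [← h]
      simpa using mul_nonneg (law_nonneg hp g c) (hr0 m c).le
    · have hc := h.trans_le l2
      have := negMulLog_le_gibbs (hP0 (m, c)) (mul_pos hc (hr0 m c)).le
        fun h0 => absurd h0 (mul_pos hc (hr0 m c)).ne'
      rw [Real.log_mul hc.ne' (hr0 m c).ne'] at this
      have h2 := mul_le_mul_of_nonneg_left (hlog m c) h.le
      linarith
  have s1 : ∑ c, ∑ m, -(P (m, c) * Real.log (law p g c)) = ∑ c, Real.negMulLog (law p g c) := by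
    refine Finset.sum_congr rfl fun c _ => ?_
    rw [Finset.sum_neg_distrib, ← Finset.sum_mul, ← law_snd_eq_sum, Real.negMulLog, neg_mul]
  have s2 : ∑ c, ∑ m, P (m, c) * (Real.log 2 + (if dec c ≠ some m then Real.log K else 0)) =
      Real.log 2 + (∑ w, if dec (g w) ≠ some (f w) then p w else 0) * Real.log K := by
    have := sum_mul_law p (fun w => (f w, g w))
      (fun x => Real.log 2 + (if dec x.2 ≠ some x.1 then Real.log K else 0))
    rw [Fintype.sum_prod_type, Finset.sum_comm] at this
    simp only [mul_comm (P _)]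
    refine this.trans ?_
    simp only [add_mul]
    rw [Finset.sum_add_distrib, ← Finset.mul_sum, h1, mul_one, Finset.sum_mul]
    congr 1
    refine Finset.sum_congr rfl fun w _ => ?_
    split_ifs <;> ring
  have s3 : ∑ c, ∑ m, (law p g c * r m c - P (m, c)) ≤ 0 := by
    refine Finset.sum_nonpos fun c _ => ?_
    rw [Finset.sum_sub_distrib, ← Finset.mul_sum, ← law_snd_eq_sum]
    have := mul_le_mul_of_nonneg_left (hr1 c) (law_nonneg hp g c)
    linarith
  have tot : ∑ c, ∑ m, Real.negMulLog (P (m, c)) ≤ ∑ c, Real.negMulLog (law p g c) +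
      (Real.log 2 + (∑ w, if dec (g w) ≠ some (f w) then p w else 0) * Real.log K) := by
    have := Finset.sum_le_sum fun c (_ : c ∈ Finset.univ) =>
      Finset.sum_le_sum fun m (_ : m ∈ Finset.univ) => term m c
    simp only [Finset.sum_add_distrib] at this
    rw [s1] at this
    linarith
  unfold entropy
  rw [Fintype.sum_prod_type, Finset.sum_comm]
  simp only [← Finset.sum_div]
  rw [← sub_div, div_le_iff₀ log_two_pos, add_mul, one_mul, mul_assoc,
    div_mul_cancel₀ _ log_two_pos.ne']
  linarith

end Fano

/-! ### The converse for wiretap codes -/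

section Converse

variable {X Y Z : Type*} [Fintype X] [Fintype Y] [Fintype Z]

/-- A coordinate of a product mass function is independent of a function of the other
coordinates. -/
theorem law_prod_coordinate {ι A V : Type*} [Fintype ι] [DecidableEq ι] [Fintype A]
    (k : ι → A → ℝ) (i : ι) (φ : ({j // j ≠ i} → A) → V) (v : V) (a : A) :
    law (fun o : ι → A => ∏ j, k j (o j)) (fun o => (φ fun j => o j, o i)) (v, a) =
      law (fun r : {j // j ≠ i} → A => ∏ j : {j // j ≠ i}, k j (r j)) φ v * k i a := by
  classical
  unfold law
  rw [← Equiv.sum_comp (Equiv.funSplitAt i A).symm, Fintype.sum_prod_type,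
    Fintype.sum_eq_single a, Finset.sum_mul]
  · refine Finset.sum_congr rfl fun r _ => ?_
    have e1 : (fun j : {j // j ≠ i} => (Equiv.funSplitAt i A).symm (a, r) j) = r := by
      funext j
      simp [Equiv.funSplitAt, Equiv.piSplitAt, j.2]
    have e2 : (Equiv.funSplitAt i A).symm (a, r) i = a := by
      simp [Equiv.funSplitAt, Equiv.piSplitAt]
    have e3 : ∏ j, k j ((Equiv.funSplitAt i A).symm (a, r) j) =
        (∏ j : {j // j ≠ i}, k j (r j)) * k i a := by
      rw [Fintype.prod_eq_mul_prod_subtype_ne _ i, e2, mul_comm]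
      congr 1
      exact Finset.prod_congr rfl fun j _ => by rw [congrFun e1 j]
    beta_reduce
    rw [e1, e2, e3]
    by_cases h : φ r = v <;> simp [h]
  · intro b hb
    refine Finset.sum_eq_zero fun r _ => if_neg fun h => hb ?_
    have := (Prod.mk.inj h).2
    simpa [Equiv.funSplitAt, Equiv.piSplitAt] using this

/-- The law of a pair of functions of the input and of the output of a kernel. -/
theorem law_kernel {A O α γ : Type*} [Fintype A] [Fintype O] (μ : A → ℝ) (κ : A → O → ℝ)
    (f : A → α) (g : O → γ) (a : α) (c : γ) [DecidableEq α] :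
    law (fun w : A × O => μ w.1 * κ w.1 w.2) (fun w => (f w.1, g w.2)) (a, c) =
      ∑ x, if f x = a then μ x * law (κ x) g c else 0 := by
  classical
  unfold law
  rw [Fintype.sum_prod_type]
  refine Finset.sum_congr rfl fun x _ => ?_
  by_cases h : f x = a
  · simp [h, Finset.mul_sum]
  · simp [h]

variable {N K : ℕ} (c : WiretapCode X Y N K) (W : Channel X Y Z)

theorem WiretapCode.joint_nonneg (w : Fin K × (Fin N → X) × (Fin N → Y × Z)) :
    0 ≤ c.joint W w :=
  mul_nonneg (mul_nonneg (by positivity) ((c.enc _).2.1 _))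
    (Finset.prod_nonneg fun _ _ => channel_nonneg W _ _)

omit [Fintype X] in
theorem sum_prod_channel (x : Fin N → X) : ∑ o : Fin N → Y × Z, ∏ j, W (x j) (o j) = 1 := by
  classical
  rw [← Fintype.piFinset_univ, ← Finset.prod_univ_sum]
  simp

theorem WiretapCode.law_joint_message (m : Fin K) :
    law (c.joint W) (fun w => w.1) m = 1 / K := by
  classical
  unfold law joint
  rw [Fintype.sum_prod_type, Fintype.sum_eq_single m fun m' h => by simp [h],
    Fintype.sum_prod_type]
  simp only [if_true, ← Finset.mul_sum, sum_prod_channel, mul_one]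
  have : ∑ x, c.enc m x = 1 := (c.enc m).2.2
  rw [this, mul_one]

theorem WiretapCode.sum_joint (hK : 1 ≤ K) : ∑ w, c.joint W w = 1 := by
  have hK0 : (K : ℝ) ≠ 0 := by positivity
  rw [← sum_law (c.joint W) (fun w => w.1)]
  simp only [law_joint_message]
  simp [hK0]

/-- The outputs at the legitimate receiver before position `i` and at the eavesdropper from `i` on. -/
def hybrid (i : ℕ) (w : Fin K × (Fin N → X) × (Fin N → Y × Z)) (j : Fin N) : Y ⊕ Z :=
  if j.val < i then Sum.inl (w.2.2 j).1 else Sum.inr (w.2.2 j).2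

/-- The hybrid output without the position `i`. -/
def hybridErase (i : Fin N) (o : {j // j ≠ i} → Y × Z) (j : {j // j ≠ i}) : Y ⊕ Z :=
  if j.1 < i then Sum.inl (o j).1 else Sum.inr (o j).2

/-- The channel is memoryless: given the outputs at the other positions, (M, X_i) → (Y_i, Z_i) is
still governed by `W`. Only the weights of (M, X_i) depend on those outputs. -/
theorem WiretapCode.law_hybridErase [DecidableEq X] (i : Fin N) (v : {j // j ≠ i} → Y ⊕ Z)
    (a : (Fin K × X) × (Y × Z)) :
    law (c.joint W) (fun w => (hybridErase i (fun j => w.2.2 j), ((w.1, w.2.1 i), w.2.2 i)))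
      (v, a) = auxLaw W (fun x => law (c.joint W)
        (fun w => (hybridErase i (fun j => w.2.2 j), (w.1, w.2.1 i))) (v, x)) a := by
  obtain ⟨⟨m, x⟩, o⟩ := a
  let t : (Fin K × (Fin N → X) × (Fin N → Y × Z)) ≃ ((Fin K × (Fin N → X)) × (Fin N → Y × Z)) :=
    (Equiv.prodAssoc _ _ _).symm
  let μ : Fin K × (Fin N → X) → ℝ := fun y => (1 / (K : ℝ)) * c.enc y.1 y.2
  let κ : Fin K × (Fin N → X) → (Fin N → Y × Z) → ℝ := fun y o => ∏ j, W (y.2 j) (o j)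
  let R : Fin K × (Fin N → X) → ℝ := fun y =>
    law (fun r : {j // j ≠ i} → Y × Z => ∏ j : {j // j ≠ i}, W (y.2 j) (r j)) (hybridErase i) v
  have hκ : ∀ y o, law (κ y) (fun o => (hybridErase i (fun j => o j), o i)) (v, o) =
      R y * W (y.2 i) o := fun y o =>
    law_prod_coordinate (fun j => (W (y.2 j) : Y × Z → ℝ)) i (hybridErase i) v o
  have hκ2 : ∀ y, law (κ y) (fun o => hybridErase i (fun j => o j)) v = R y := by
    intro y
    rw [law_fst_eq_sum (κ y) (fun o => hybridErase i (fun j => o j)) (fun o => o i)]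
    simp only [hκ]
    rw [← Finset.mul_sum, channel_sum, mul_one]
  have hj : law (c.joint W) t = fun w => μ w.1 * κ w.1 w.2 := by
    funext w
    rw [law_equiv]
    rfl
  have h1 : law (c.joint W)
      (fun w => (hybridErase i (fun j => w.2.2 j), ((w.1, w.2.1 i), w.2.2 i)))
      (v, ((m, x), o)) = ∑ y, if (y.1, y.2 i) = (m, x) then μ y * (R y * W (y.2 i) o) else 0 := by
    have e := law_injective (c.joint W)
      (fun w => ((w.1, w.2.1 i), (hybridErase i (fun j => w.2.2 j), w.2.2 i)))
      (e := fun z : (Fin K × X) × (({j // j ≠ i} → Y ⊕ Z) × (Y × Z)) =>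
        (z.2.1, (z.1, z.2.2))) (by
          rintro ⟨a, b, c⟩ ⟨a', b', c'⟩ h
          simp only [Prod.mk.injEq] at h ⊢
          tauto) ((m, x), (v, o))
    refine e.trans ?_
    have e2 := law_comp (c.joint W) t (fun z => ((z.1.1, z.1.2 i),
      (hybridErase i (fun j => z.2 j), z.2 i)))
    refine (congrFun e2 _).trans ?_
    rw [hj, law_kernel μ κ (fun y => (y.1, y.2 i))
      (fun o => (hybridErase i (fun j => o j), o i))]
    simp only [hκ]
  have h2 : law (c.joint W)
      (fun w => (hybridErase i (fun j => w.2.2 j), (w.1, w.2.1 i)))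
      (v, (m, x)) = ∑ y, if (y.1, y.2 i) = (m, x) then μ y * R y else 0 := by
    have e := law_injective (c.joint W)
      (fun w => ((w.1, w.2.1 i), hybridErase i (fun j => w.2.2 j)))
      (e := Prod.swap) Prod.swap_injective ((m, x), v)
    refine e.trans ?_
    have e2 := law_comp (c.joint W) t (fun z => ((z.1.1, z.1.2 i),
      hybridErase i (fun j => z.2 j)))
    refine (congrFun e2 _).trans ?_
    rw [hj, law_kernel μ κ (fun y => (y.1, y.2 i)) (fun o => hybridErase i (fun j => o j))]
    simp only [hκ2]
  rw [h1, auxLaw]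
  simp only
  rw [h2, Finset.sum_mul]
  refine Finset.sum_congr rfl fun y _ => ?_
  split_ifs with h
  · rw [(Prod.mk.inj h).2]
    ring
  · simp

/-- Insertion of the output at position `i`. -/
def insertAt (i : Fin N) (z : ({j // j ≠ i} → Y ⊕ Z) × (Y ⊕ Z)) : Fin N → Y ⊕ Z :=
  (Equiv.funSplitAt i (Y ⊕ Z)).symm z.swap

omit [Fintype Y] [Fintype Z] in
theorem insertAt_injective (i : Fin N) : Function.Injective (insertAt (Y := Y) (Z := Z) i) :=
  (Equiv.injective _).comp Prod.swap_injective

omit [Fintype X] [Fintype Y] [Fintype Z] in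
theorem hybrid_succ (i : Fin N) (w : Fin K × (Fin N → X) × (Fin N → Y × Z)) :
    hybrid (i.val + 1) w =
      insertAt i (hybridErase i (fun j => w.2.2 j), Sum.inl (w.2.2 i).1) := by
  funext j
  by_cases h : j = i
  · subst h
    simp [hybrid, insertAt, Equiv.funSplitAt, Equiv.piSplitAt]
  · have h' : j.val < i.val + 1 ↔ j < i := by
      rw [Fin.lt_def]
      have := Fin.val_ne_of_ne h
      omega
    simp only [hybrid, insertAt, Equiv.funSplitAt, Equiv.piSplitAt, h']
    simp [h]
    rfl

omit [Fintype X] [Fintype Y] [Fintype Z] in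
theorem hybrid_self (i : Fin N) (w : Fin K × (Fin N → X) × (Fin N → Y × Z)) :
    hybrid i.val w =
      insertAt i (hybridErase i (fun j => w.2.2 j), Sum.inr (w.2.2 i).2) := by
  funext j
  by_cases h : j = i
  · subst h
    simp [hybrid, insertAt, Equiv.funSplitAt, Equiv.piSplitAt]
  · simp only [hybrid, insertAt, Equiv.funSplitAt, Equiv.piSplitAt]
    simp [h]
    rfl

/-- `I(M; hybrid) - H(M)`. -/
noncomputable def WiretapCode.hybridInfo (i : ℕ) : ℝ :=
  entropy (c.joint W) (fun w => hybrid i w) - entropy (c.joint W) (fun w => (w.1, hybrid i w))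

/-- Both entropies contain the contribution of the erased hybrid output V. Splitting by its values
leaves, for each `v`, a difference of entropies at position `i` alone. -/
theorem entropy_insertAt {B : Type*} [Fintype B] (p : Fin K × (Fin N → X) × (Fin N → Y × Z) → ℝ)
    (i : Fin N) (h : Y × Z → B) {e : B → Y ⊕ Z} (he : Function.Injective e) :
    entropy p (fun w => insertAt i (hybridErase i (fun j => w.2.2 j), e (h (w.2.2 i)))) -
      entropy p (fun w => (w.1, insertAt i (hybridErase i (fun j => w.2.2 j), e (h (w.2.2 i))))) =
    ∑ v, (entropy (fun a => law p (fun w => (hybridErase i (fun j => w.2.2 j),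
        ((w.1, w.2.1 i), w.2.2 i))) (v, a)) (fun a => h a.2) -
      entropy (fun a => law p (fun w => (hybridErase i (fun j => w.2.2 j),
        ((w.1, w.2.1 i), w.2.2 i))) (v, a)) (fun a => (a.1.1, h a.2))) := by
  have e1 := entropy_injective p (fun w => (hybridErase i (fun j => w.2.2 j), h (w.2.2 i)))
    (e := fun z => insertAt i (z.1, e z.2)) (by
      intro z z' hz
      have := Prod.mk.inj (insertAt_injective i hz)
      exact Prod.ext this.1 (he this.2))
  have e2 := entropy_injective p (fun w => (hybridErase i (fun j => w.2.2 j), (w.1, h (w.2.2 i))))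
    (e := fun z => (z.2.1, insertAt i (z.1, e z.2.2))) (by
      intro z z' hz
      have h1 := (Prod.mk.inj hz).1
      have h2 := Prod.mk.inj (insertAt_injective i (Prod.mk.inj hz).2)
      exact Prod.ext h2.1 (Prod.ext h1 (he h2.2)))
  rw [e1, e2, Finset.sum_sub_distrib,
    entropy_prod_eq_sum p (fun w => hybridErase i (fun j => w.2.2 j))
      (fun w => ((w.1, w.2.1 i), w.2.2 i)) (fun a => h a.2),
    entropy_prod_eq_sum p (fun w => hybridErase i (fun j => w.2.2 j))
      (fun w => ((w.1, w.2.1 i), w.2.2 i)) (fun a => (a.1.1, h a.2))]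

/-- Consecutive hybrids differ only at position `i`, so the increment is I(M; Y_i | V) - I(M; Z_i |
V), where V denotes the outputs common to both. For each value of V, the message is an admissible
auxiliary variable and `secrecyGap_le` applies. This takes the place of Csiszár's sum identity. -/
theorem WiretapCode.hybridInfo_succ_le (hK : 1 ≤ K) (i : Fin N) :
    c.hybridInfo W (i.val + 1) ≤ c.hybridInfo W i.val + secrecyCapacity W := by
  classical
  unfold hybridInfo
  simp only [hybrid_succ, hybrid_self]
  rw [entropy_insertAt (c.joint W) i Prod.fst Sum.inl_injective,
    entropy_insertAt (c.joint W) i Prod.snd Sum.inr_injective, ← sub_le_iff_le_add',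
    ← Finset.sum_sub_distrib]
  have hl : ∀ v : {j // j ≠ i} → Y ⊕ Z, (fun a => law (c.joint W)
      (fun w => (hybridErase i (fun j => w.2.2 j), ((w.1, w.2.1 i), w.2.2 i))) (v, a)) =
      auxLaw W (fun x => law (c.joint W)
        (fun w => (hybridErase i (fun j => w.2.2 j), (w.1, w.2.1 i))) (v, x)) := fun v =>
    funext fun a => c.law_hybridErase W i v a
  simp only [hl]
  have hs : ∑ v, ∑ x, law (c.joint W)
      (fun w => (hybridErase i (fun j => w.2.2 j), (w.1, w.2.1 i))) (v, x) = 1 := by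
    rw [← Fintype.sum_prod_type, sum_law, c.sum_joint W hK]
  calc _ ≤ ∑ v, (∑ x, law (c.joint W)
      (fun w => (hybridErase i (fun j => w.2.2 j), (w.1, w.2.1 i))) (v, x)) *
        secrecyCapacity W := by
        refine Finset.sum_le_sum fun v _ => ?_
        exact secrecyGap_le W fun x => law_nonneg (c.joint_nonneg W) _ _
    _ = secrecyCapacity W := by rw [← Finset.sum_mul, hs, one_mul]

theorem WiretapCode.hybridInfo_le (hK : 1 ≤ K) (i : ℕ) (hi : i ≤ N) :
    c.hybridInfo W i ≤ c.hybridInfo W 0 + i * secrecyCapacity W := by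
  induction i with
  | zero => simp
  | succ i ih =>
    have h1 := c.hybridInfo_succ_le W hK ⟨i, hi⟩
    have h2 := ih (by omega)
    push_cast
    simp only at h1
    linarith

theorem WiretapCode.entropy_message (hK : 1 ≤ K) :
    entropy (c.joint W) (fun w => w.1) = Real.log K / Real.log 2 := by
  have hK0 : (K : ℝ) ≠ 0 := by positivity
  unfold entropy
  simp only [law_joint_message]
  rw [Finset.sum_const, Finset.card_univ, Fintype.card_fin, nsmul_eq_mul, Real.negMulLog, one_div,
    Real.log_inv]
  field_simp

/-- The converse: `(1 - P_e) log K ≤ 1 + I(M; Z^N) + N C_s`. -/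
theorem WiretapCode.converse (hK : 1 ≤ K) :
    (1 - c.errorProb W) * (Real.log K / Real.log 2) ≤
      1 + c.leakage W + N * secrecyCapacity W := by
  have h1 := c.hybridInfo_le W hK N le_rfl
  have h2 := le_entropy_sub_of_uniform hK (c.joint_nonneg W) (c.sum_joint W hK) (fun w => w.1)
    (fun w => fun j => (w.2.2 j).1) c.dec
  have h3 : c.hybridInfo W N = entropy (c.joint W) (fun w => fun j => (w.2.2 j).1) -
      entropy (c.joint W) (fun w => (w.1, fun j => (w.2.2 j).1)) := by
    have e : ∀ w : Fin K × (Fin N → X) × (Fin N → Y × Z), hybrid N w =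
        fun j => Sum.inl ((fun j => (w.2.2 j).1) j) := fun w => funext fun j => if_pos j.isLt
    have hi : Function.Injective (fun (y : Fin N → Y) j => (Sum.inl (y j) : Y ⊕ Z)) :=
      fun y y' h => funext fun j => Sum.inl_injective (congrFun h j)
    unfold hybridInfo
    simp only [e]
    rw [entropy_injective (c.joint W) (fun w => fun j => (w.2.2 j).1) hi,
      entropy_injective (c.joint W) (fun w => (w.1, fun j => (w.2.2 j).1))
        (e := fun z : Fin K × (Fin N → Y) => (z.1, fun j => (Sum.inl (z.2 j) : Y ⊕ Z)))
        fun z z' h => Prod.ext (Prod.mk.inj h).1 (hi (Prod.mk.inj h).2)]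
  have h4 : c.hybridInfo W 0 = entropy (c.joint W) (fun w => fun j => (w.2.2 j).2) -
      entropy (c.joint W) (fun w => (fun j => (w.2.2 j).2, w.1)) := by
    have e : ∀ w : Fin K × (Fin N → X) × (Fin N → Y × Z), hybrid 0 w =
        fun j => Sum.inr ((fun j => (w.2.2 j).2) j) := fun w => funext fun j =>
      if_neg (Nat.not_lt_zero _)
    have hi : Function.Injective (fun (y : Fin N → Z) j => (Sum.inr (y j) : Y ⊕ Z)) :=
      fun y y' h => funext fun j => Sum.inr_injective (congrFun h j)
    unfold hybridInfo
    simp only [e]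
    rw [entropy_injective (c.joint W) (fun w => fun j => (w.2.2 j).2) hi,
      entropy_injective (c.joint W) (fun w => (fun j => (w.2.2 j).2, w.1))
        (e := fun z : (Fin N → Z) × Fin K => (z.2, fun j => (Sum.inr (z.1 j) : Y ⊕ Z)))
        fun z z' h => Prod.ext (hi (Prod.mk.inj h).2) (Prod.mk.inj h).1]
  have h5 := c.entropy_message W hK
  unfold leakage mutualInfo errorProb
  rw [h3, h4] at h1
  linarith

end Converse

/-! ### The universal secrecy capacity -/

section Universal

variable {St X Y Z : Type*} [Fintype X] [Nonempty X] [Fintype Y] [Fintype Z]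

omit [Nonempty X] in
-- The converse is divided by N, using log₂ K ≥ N R, and N tends to infinity. Multiplying by 1 - P_e
-- requires P_e ≤ 1, which holds eventually.
theorem le_secrecyCapacity_of_mem_universalRates {W : St → Channel X Y Z} {R : ℝ}
    (hR : R ∈ universalRates W) (s : St) : R ≤ secrecyCapacity (W s) := by
  obtain ⟨c, hc⟩ := hR
  obtain ⟨he, hl⟩ := hc s
  have t1 : Tendsto (fun N : ℕ => (1 - (c N).errorProb (W s)) * R) atTop (𝓝 R) := by
    simpa using (he.const_sub 1).mul_const R
  have t2 : Tendsto (fun N : ℕ => (1 + (c N).leakage (W s)) / N + secrecyCapacity (W s)) atTop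
      (𝓝 (secrecyCapacity (W s))) := by
    simpa using ((hl.const_add 1).div_atTop tendsto_natCast_atTop_atTop).add_const
      (secrecyCapacity (W s))
  refine le_of_tendsto_of_tendsto t1 t2 ?_
  filter_upwards [eventually_gt_atTop 0, he.eventually_le_const zero_lt_one] with N hN hN1
  have hN0 : (0 : ℝ) < N := by exact_mod_cast hN
  have hp : (0 : ℝ) < (2 : ℝ) ^ ((N : ℝ) * R) := by positivity
  have h1 := (c N).converse (W s) (Nat.one_le_iff_ne_zero.2 (Nat.ceil_pos.2 hp).ne')
  have h2 : (N : ℝ) * R ≤ Real.log (⌈(2 : ℝ) ^ ((N : ℝ) * R)⌉₊ : ℝ) / Real.log 2 := by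
    rw [le_div_iff₀ log_two_pos, ← Real.log_rpow (by norm_num)]
    exact Real.log_le_log hp (Nat.le_ceil _)
  have h3 := mul_le_mul_of_nonneg_left h2 (show 0 ≤ 1 - (c N).errorProb (W s) by linarith)
  rw [← sub_le_iff_le_add, le_div_iff₀ hN0]
  linarith

omit [Nonempty X] in
theorem bddAbove_universalRates [Nonempty St] (W : St → Channel X Y Z) :
    BddAbove (universalRates W) :=
  ⟨secrecyCapacity (W (Classical.arbitrary St)), fun _ hR =>
    le_secrecyCapacity_of_mem_universalRates hR _⟩

/-- If no rate were achievable, the supremum would take the default value 0; nonnegativity of the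
capacities covers this case. -/
theorem universalSecrecyCapacity_le [Fintype St] [Nonempty St] (W : St → Channel X Y Z) :
    universalSecrecyCapacity W ≤ minSecrecyCapacity W :=
  Real.sSup_le
    (fun _ hR => Finset.le_inf' _ _ fun s _ => le_secrecyCapacity_of_mem_universalRates hR s)
    (Finset.le_inf' _ _ fun s _ => secrecyCapacity_nonneg (W s))

end Universal

/-! ### Rates of several rounds -/

section Rounds

variable {St : Type*} {t : ℕ} (s s' : Fin t → St)

theorem card_matched_add_card_mismatched : (matched s s').card + (mismatched s s').card = t := by
  classical
  have := Finset.card_filter_add_card_filter_not (s := (Finset.univ : Finset (Fin t)))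
    (fun i => s' i = s i)
  rw [Finset.card_univ, Fintype.card_fin] at this
  convert this using 3 <;> simp [matched, mismatched]

theorem mismatchTerm_le {n : ℕ} (I E : St → Finset (Fin (2 ^ n))) :
    mismatchTerm I E s s' ≤ (mismatched s s').card / t := by
  unfold mismatchTerm
  rw [one_div, inv_mul_eq_div]
  refine div_le_div_of_nonneg_right ?_ (Nat.cast_nonneg t)
  rw [← mul_one ((mismatched s s').card : ℝ), ← nsmul_eq_mul]
  refine Finset.sum_le_card_nsmul _ _ _ fun i _ => ?_
  rw [div_le_one (by positivity)]
  have := Finset.card_le_univ (setXi I E (s i) (s' i))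
  rw [Fintype.card_fin] at this
  exact_mod_cast this

theorem secrecyRate_eq {n : ℕ} (I E : St → Finset (Fin (2 ^ n))) :
    secrecyRate I E s s' = (1 / (t : ℝ)) *
      ∑ i ∈ matched s s', ((I (s' i) \ E (s' i)).card : ℝ) / (2 ^ n : ℕ) +
        mismatchTerm I E s s' := by
  unfold secrecyRate mismatchTerm
  rw [← Finset.sum_div, ← Finset.sum_div]
  have : ((2 ^ n : ℕ) : ℝ) ≠ 0 := by positivity
  rcases Nat.eq_zero_or_pos t with rfl | ht
  · simp
  · field_simp

/-- In a matched round the estimated sets are those of the actual state. Since capacities are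
nonnegative and t_∨ ≤ t, dividing by `t` gives at most the average over the matched rounds. Without
matched rounds both averages are 0. -/
theorem secrecyRate_le {X Y Z : Type*} [Fintype X] [Nonempty X] [Fintype Y] [Fintype Z]
    (W : St → Channel X Y Z) {n : ℕ} (I E : St → Finset (Fin (2 ^ n))) {ε : ℝ} (hε : 0 ≤ ε)
    (h : ∀ a, ((I a \ E a).card : ℝ) / (2 ^ n : ℕ) ≤ secrecyCapacity (W a) + ε) :
    secrecyRate I E s s' ≤ avgMatchedCapacity W s s' + mismatchTerm I E s s' + ε := by
  rw [secrecyRate_eq]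
  have h1 : ∑ i ∈ matched s s', ((I (s' i) \ E (s' i)).card : ℝ) / (2 ^ n : ℕ) ≤
      ∑ i ∈ matched s s', secrecyCapacity (W (s i)) + (matched s s').card * ε := by
    rw [← nsmul_eq_mul, ← Finset.sum_const, ← Finset.sum_add_distrib]
    refine Finset.sum_le_sum fun i hi => ?_
    have hi' : s' i = s i := by
      simpa [matched] using hi
    rw [hi']
    exact h (s i)
  have h0 : 0 ≤ ∑ i ∈ matched s s', secrecyCapacity (W (s i)) :=
    Finset.sum_nonneg fun i _ => secrecyCapacity_nonneg _
  have hc : (matched s s').card ≤ t := by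
    have := card_matched_add_card_mismatched s s'
    omega
  have hc' : ((matched s s').card : ℝ) ≤ t := by exact_mod_cast hc
  have h2 : (1 / (t : ℝ)) * ∑ i ∈ matched s s', ((I (s' i) \ E (s' i)).card : ℝ) / (2 ^ n : ℕ) ≤
      avgMatchedCapacity W s s' + ε := by
    unfold avgMatchedCapacity
    rcases Nat.eq_zero_or_pos (matched s s').card with hm | hm
    · rw [Finset.card_eq_zero] at hm
      simp [hm, hε]
    · have hm' : (0 : ℝ) < (matched s s').card := by exact_mod_cast hm
      have ht : (0 : ℝ) < t := hm'.trans_le hc'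
      calc _ ≤ (1 / (t : ℝ)) * (∑ i ∈ matched s s', secrecyCapacity (W (s i)) +
            (matched s s').card * ε) := mul_le_mul_of_nonneg_left h1 (by positivity)
        _ = (1 / (t : ℝ)) * ∑ i ∈ matched s s', secrecyCapacity (W (s i)) +
            ((matched s s').card / t) * ε := by ring
        _ ≤ _ := by
            refine add_le_add (mul_le_mul_of_nonneg_right
              (one_div_le_one_div_of_le hm' hc') h0) ?_
            exact mul_le_of_le_one_left hε ((div_le_one ht).2 hc')
  linarith

theorem minSecrecyCapacity_le_avg {X Y Z : Type*} [Fintype St] [Nonempty St] [Fintype X]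
    [Fintype Y] [Fintype Z] (W : St → Channel X Y Z) (hm : (matched s s').Nonempty) :
    minSecrecyCapacity W ≤ avgMatchedCapacity W s s' ∧
      (minSecrecyCapacity W < avgMatchedCapacity W s s' ↔
        ∃ i ∈ matched s s', minSecrecyCapacity W < secrecyCapacity (W (s i))) := by
  have hc : (0 : ℝ) < (matched s s').card := by exact_mod_cast hm.card_pos
  have hle : ∀ a, minSecrecyCapacity W ≤ secrecyCapacity (W a) := fun a =>
    Finset.inf'_le _ (Finset.mem_univ a)
  have hconst : ∑ i ∈ matched s s', minSecrecyCapacity W =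
      minSecrecyCapacity W * (matched s s').card := by
    rw [Finset.sum_const, nsmul_eq_mul, mul_comm]
  unfold avgMatchedCapacity
  rw [one_div, inv_mul_eq_div, le_div_iff₀ hc, lt_div_iff₀ hc, ← hconst]
  refine ⟨Finset.sum_le_sum fun i _ => hle _, fun h => Finset.exists_lt_of_sum_lt h, ?_⟩
  rintro ⟨i, hi, h⟩
  exact Finset.sum_lt_sum (fun i _ => hle _) ⟨i, hi, h⟩

end Rounds

/-- Because |E| is the maximum of |B| over all states, it is at least |B| for the state itself, and
|I \ E| ≤ |I| - |B|. -/
theorem eventually_card_sdiff_le {St Y Z : Type*} [Fintype St] [Fintype Y] [Fintype Z]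
    (W : St → Channel (ZMod 2) Y Z) {β : ℝ} (hβ0 : 0 < β) (hβ1 : β < 1 / 2)
    (Q : St → stdSimplex ℝ (ZMod 2)) (E : (n : ℕ) → St → Finset (Fin (2 ^ n)))
    (hE : ∀ᶠ n in atTop, ∀ s, E n s ⊆ setI β (Q s) (W s) n ∧ (E n s).card = maxB β Q W n)
    {ε : ℝ} (hε : 0 < ε) : ∀ᶠ n in atTop, ∀ a, ((setI β (Q a) (W a) n \ E n a).card : ℝ) /
      (2 ^ n : ℕ) ≤ secrecyCapacity (W a) + ε := by
  filter_upwards [hE, eventually_all.2 fun a =>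
    eventually_card_setI_sub_le (β := β) (Q a) (W a) hβ0 hβ1 hε] with n hn hn' a
  have h1 := hn' a
  obtain ⟨h2, h3⟩ := hn a
  have h4 : (setB β (Q a) (W a) n).card ≤ maxB β Q W n :=
    Finset.le_sup (f := fun s => (setB β (Q s) (W s) n).card) (Finset.mem_univ a)
  have h5 : ((setB β (Q a) (W a) n).card : ℝ) ≤ (E n a).card := by
    rw [h3]; exact_mod_cast h4
  have h6 : ((setI β (Q a) (W a) n \ E n a).card : ℝ) =
      (setI β (Q a) (W a) n).card - (E n a).card := by
    rw [Finset.card_sdiff_of_subset h2, Nat.cast_sub (Finset.card_le_card h2)]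
  have h7 := ent_sub_ent_le_secrecyCapacity (Q a) (W a)
  have h8 : (2 : ℝ) ^ n * (((channelSource (Q a) (W a) Prod.snd).ent -
      (channelSource (Q a) (W a) Prod.fst).ent) / Real.log 2 + ε) ≤
      2 ^ n * (secrecyCapacity (W a) + ε) := by gcongr
  rw [div_le_iff₀ (by positivity), h6]
  push_cast
  linarith

/-! ### Probabilities in the hidden Markov model -/

section HMMProb

variable {St Ob : Type*} [Fintype St] [Fintype Ob] (l : HMM St Ob)

theorem HMM.pathProb_nonneg {T : ℕ} (s : Fin T → St) (o : Fin T → Ob) : 0 ≤ l.pathProb s o := by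
  refine Finset.prod_nonneg fun k _ => mul_nonneg ?_ ((l.emit _).2.1 _)
  split_ifs
  exacts [l.init.2.1 _, (l.trans _).2.1 _]

/-- One more round multiplies the path probability by a transition and an emission; for T = 0 the
transition is replaced by the initial law. Summing out the last round then shows that the total mass
is 1. -/
theorem HMM.pathProb_snoc {T : ℕ} (s : Fin T → St) (o : Fin T → Ob) (a : St) (b : Ob) :
    l.pathProb (Fin.snoc (α := fun _ => St) s a) (Fin.snoc (α := fun _ => Ob) o b) =
      l.pathProb s o * ((if h : T = 0 then l.init a else
        l.trans (s ⟨T - 1, by omega⟩) a) * l.emit a b) := by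
  unfold pathProb
  rw [Fin.prod_univ_castSucc]
  congr 1
  · refine Finset.prod_congr rfl fun k _ => ?_
    simp only [Fin.snoc_castSucc, Fin.val_castSucc]
    congr 1
    split_ifs with h
    · rfl
    · have : (⟨k.val - 1, by omega⟩ : Fin (T + 1)) =
          Fin.castSucc ⟨k.val - 1, by omega⟩ := rfl
      rw [this, Fin.snoc_castSucc]
  · simp only [Fin.snoc_last, Fin.val_last]
    congr 1
    split_ifs with h
    · rfl
    · have : (⟨T - 1, by omega⟩ : Fin (T + 1)) = Fin.castSucc ⟨T - 1, by omega⟩ := rfl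
      rw [this, Fin.snoc_castSucc]

theorem HMM.sum_pathProb (T : ℕ) :
    ∑ s : Fin T → St, ∑ o : Fin T → Ob, l.pathProb s o = 1 := by
  induction T with
  | zero => simp [HMM.pathProb]
  | succ T ih =>
    rw [← ih, ← Equiv.sum_comp (Fin.snocEquiv fun _ => St), Fintype.sum_prod_type, Finset.sum_comm]
    refine Finset.sum_congr rfl fun s _ => ?_
    have h : ∀ a, ∑ o, l.pathProb (Fin.snocEquiv (fun _ => St) (a, s)) o = ∑ b, ∑ o : Fin T → Ob,
        l.pathProb s o * ((if h : T = 0 then l.init a else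
          l.trans (s ⟨T - 1, by omega⟩) a) * l.emit a b) := by
      intro a
      rw [← Equiv.sum_comp (Fin.snocEquiv fun _ => Ob), Fintype.sum_prod_type]
      exact Finset.sum_congr rfl fun b _ => Finset.sum_congr rfl fun o _ =>
        l.pathProb_snoc s o a b
    simp only [h, ← Finset.sum_mul, ← Finset.mul_sum]
    have he : ∀ a, ∑ b, l.emit a b = 1 := fun a => (l.emit a).2.2
    simp only [he, mul_one]
    have ht : ∑ a, (if h : T = 0 then l.init a else l.trans (s ⟨T - 1, by omega⟩) a) = 1 := by
      by_cases h : T = 0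
      · simp only [h, dif_pos]; exact l.init.2.2
      · simp only [h]; exact (l.trans _).2.2
    rw [ht, mul_one]

theorem HMM.prob_le_one {T : ℕ} (P : (Fin T → St) → (Fin T → Ob) → Prop) : l.prob P ≤ 1 := by
  classical
  rw [← l.sum_pathProb T]
  refine Finset.sum_le_sum fun s _ => Finset.sum_le_sum fun o _ => ?_
  split_ifs
  exacts [le_rfl, l.pathProb_nonneg s o]

theorem HMM.one_le_prob_add_prob {T : ℕ} {P P' : (Fin T → St) → (Fin T → Ob) → Prop}
    (h : ∀ s o, P s o ∨ P' s o) : 1 ≤ l.prob P + l.prob P' := by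
  classical
  rw [← l.sum_pathProb T]
  unfold prob
  simp only [← Finset.sum_add_distrib]
  refine Finset.sum_le_sum fun s _ => Finset.sum_le_sum fun o _ => ?_
  have := l.pathProb_nonneg s o
  rcases h s o with h | h
  · rw [if_pos h]; split_ifs <;> linarith
  · rw [if_pos h]; split_ifs <;> linarith

end HMMProb

end GVWTC

theorem mainTheorem2
    {St Ob Y Z : Type*} [Fintype St] [Nonempty St] [Fintype Ob] [Fintype Y] [Fintype Z]
    (W : St → Channel (ZMod 2) Y Z)
    (hmm : HMM St Ob) (𝕃 : Learner St Ob) (𝔻 : StateDecoder St Ob)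
    (β : ℝ) (hβ0 : 0 < β) (hβ1 : β < 1 / 2)
    (Q : St → stdSimplex ℝ (ZMod 2))
    (E : (n : ℕ) → St → Finset (Fin (2 ^ n)))
    (hE : ∀ᶠ n in atTop, ∀ s, E n s ⊆ setI β (Q s) (W s) n ∧ (E n s).card = maxB β Q W n) :
    -- the rate bound for all numbers of rounds and all sequences of actual / estimated states
    (∀ ε : ℝ, 0 < ε → ∀ᶠ n in atTop, ∀ (t : ℕ) (s s' : Fin t → St),
      secrecyRate (fun a => setI β (Q a) (W a) n) (E n) s s' ≤
        avgMatchedCapacity W s s' +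
          mismatchTerm (fun a => setI β (Q a) (W a) n) (E n) s s' + ε) ∧
    -- the bound along `ω + t → ∞`, `N → ∞`, when the fraction of mismatched rounds vanishes
    (∀ l : Filter (ℕ × ℕ), Tendsto (fun p : ℕ × ℕ => p.1 + p.2) l atTop →
      (∀ᶠ p in l, 1 ≤ p.2) →
      (∀ δ : ℝ, 0 < δ → Tendsto (fun p : ℕ × ℕ =>
        hmm.prob (T := p.1 + p.2) fun s o =>
          δ * p.2 < ((mismatched (secureStates s) (estimatedStates 𝕃 𝔻 o)).card : ℝ)) l (𝓝 0)) →
      ∀ ε : ℝ, 0 < ε → Tendsto (fun q : (ℕ × ℕ) × ℕ =>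
        hmm.prob (T := q.1.1 + q.1.2) fun s o =>
          (matched (secureStates s) (estimatedStates 𝕃 𝔻 o)).Nonempty ∧
          secrecyRate (fun a => setI β (Q a) (W a) q.2) (E q.2)
              (secureStates s) (estimatedStates 𝕃 𝔻 o) ≤
            avgMatchedCapacity W (secureStates s) (estimatedStates 𝕃 𝔻 o) + ε)
        (l ×ˢ atTop) (𝓝 1)) ∧
    -- the bound is at least `min_S C_s`, strictly iff a matched state is better than the worst one
    (∀ (t : ℕ) (s s' : Fin t → St), (matched s s').Nonempty →
      minSecrecyCapacity W ≤ avgMatchedCapacity W s s' ∧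
      (minSecrecyCapacity W < avgMatchedCapacity W s s' ↔
        ∃ i ∈ matched s s', minSecrecyCapacity W < secrecyCapacity (W (s i)))) ∧
    -- `min_S C_s` is an upper bound on the universal secrecy capacity
    BddAbove (universalRates W) ∧ universalSecrecyCapacity W ≤ minSecrecyCapacity W := by
  have bound : ∀ ε : ℝ, 0 < ε → ∀ᶠ n in atTop, ∀ (t : ℕ) (s s' : Fin t → St),
      secrecyRate (fun a => setI β (Q a) (W a) n) (E n) s s' ≤
        avgMatchedCapacity W s s' +
          mismatchTerm (fun a => setI β (Q a) (W a) n) (E n) s s' + ε := by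
    intro ε hε
    filter_upwards [eventually_card_sdiff_le W hβ0 hβ1 Q E hE hε] with n hn t s s'
    exact secrecyRate_le s s' W _ _ hε.le hn
  refine ⟨bound, ?_, fun t s s' hm => minSecrecyCapacity_le_avg s s' W hm,
    bddAbove_universalRates W, universalSecrecyCapacity_le W⟩
  intro l _ hl1 hmis ε hε
  -- A mismatched fraction of at most ε / 2 bounds the mismatch term; a fraction of at most 1 / 2
  -- guarantees a matched round.
  have hδ : 0 < min (ε / 2) (1 / 2) := by positivity
  have lim := (hmis _ hδ).const_sub 1
  rw [sub_zero] at lim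
  refine tendsto_of_tendsto_of_tendsto_of_le_of_le' (lim.comp tendsto_fst) tendsto_const_nhds ?_
    (Eventually.of_forall fun q => hmm.prob_le_one _)
  filter_upwards [(tendsto_fst (g := atTop)).eventually hl1,
    tendsto_snd.eventually (bound (ε / 2) (by positivity))] with q hq1 hq2
  have ht : (0 : ℝ) < q.1.2 := by exact_mod_cast hq1
  -- The event of too many mismatches and the desired event together cover all paths, so the
  -- probability of the latter is at least one minus a quantity that tends to 0.
  have key : 1 ≤ hmm.prob (T := q.1.1 + q.1.2) (fun s o => min (ε / 2) (1 / 2) * q.1.2 <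
      ((mismatched (secureStates s) (estimatedStates 𝕃 𝔻 o)).card : ℝ)) + _ :=
    hmm.one_le_prob_add_prob fun s o => or_iff_not_imp_left.2 fun h => by
      push Not at h
      have h1 := card_matched_add_card_mismatched (secureStates s) (estimatedStates 𝕃 𝔻 o)
      have h1' : ((matched (secureStates s) (estimatedStates 𝕃 𝔻 o)).card : ℝ) +
          (mismatched (secureStates s) (estimatedStates 𝕃 𝔻 o)).card = q.1.2 := by
        exact_mod_cast h1
      have h2 := mul_le_mul_of_nonneg_right (min_le_left (ε / 2) (1 / 2)) ht.le
      have h3 := mul_le_mul_of_nonneg_right (min_le_right (ε / 2) (1 / 2)) ht.le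
      refine (⟨?_, ?_⟩ : (matched (secureStates s) (estimatedStates 𝕃 𝔻 o)).Nonempty ∧
          secrecyRate (fun a => setI β (Q a) (W a) q.2) (E q.2)
              (secureStates s) (estimatedStates 𝕃 𝔻 o) ≤
            avgMatchedCapacity W (secureStates s) (estimatedStates 𝕃 𝔻 o) + ε)
      · rw [← Finset.card_pos]
        have : (0 : ℝ) < (matched (secureStates s) (estimatedStates 𝕃 𝔻 o)).card := by linarith
        exact_mod_cast this
      · have h4 := hq2 _ (secureStates s) (estimatedStates 𝕃 𝔻 o)
        have h5 := mismatchTerm_le (secureStates s) (estimatedStates 𝕃 𝔻 o)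
          (fun a => setI β (Q a) (W a) q.2) (E q.2)
        have h6 : ((mismatched (secureStates s) (estimatedStates 𝕃 𝔻 o)).card : ℝ) / q.1.2 ≤
            ε / 2 := by
          rw [div_le_iff₀ ht]; linarith
        linarith
  simp only [Function.comp_apply]
  linarith
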